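/- **Setting.** Let $\mathcal X$ be a non-empty compact metric space (for instance a compact subset of Euclidean space) with its Borel $\sigma$-algebra, $\mathcal A$ a finite non-empty set of $A$ actions, $H\ge 1$ an integer, $r:\mathcal X\times\mathcal A\to[0,1]$ measurable and $p(\cdot\,|\,x,a)$ a stochastic kernel on $\mathcal X$ given $\mathcal X\times\mathcal A$. A (randomised Markovian) policy is a sequence $\pi=(\pi_t)_t$ of stochastic kernels on $\mathcal A$ given $\mathcal X$; it is deterministic if each $\pi_t$ is given by a measurable map $\mathcal X\to\mathcal A$. For $t\in[H]=\{1,\dots,H\}$ let $V_t^\pi(x)=\mathbb E\big[\sum_{t'=t}^H r(x_{t'},a_{t'})\big]$, where $x_t=x$, $a_{t'}\sim\pi_{t'}(\cdot|x_{t'})$, $x_{t'+1}\sim p(\cdot|x_{t'},a_{t'})$, and let $V_t^*(x)=\sup_\pi V_t^\pi(x)$ over all policies. A policy $\pi$ is $e$-optimal if $V_1^\pi(x)\ge V_1^{\pi'}(x)-e$ for all $x$ and all policies $\pi'$. Assume that for constants $L,\alpha\ge 0$, for all $x,x',a$, $$|r(x,a)-r(x',a)|\le L\,d(x,x')^\alpha,\qquad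 \sup_{B}|p(B|x,a)-p(B|x',a)|\le L\,d(x,x')^\alpha .$$ Let $n\ge1$, let $\mathcal S_n\subset\mathcal X$ be a finite $\frac1n$-net (every $x\in\mathcal X$ is within distance $\frac1n$ of $\mathcal S_n$), and let $Q:\mathcal X\to\mathcal S_n$ be a measurable nearest-neighbour map. Let $\varepsilon>0$, $\delta\in(0,1)$, $\eta:=Ln^{-\alpha}$, $K:=\max\{0,\lceil\log_2(H/\varepsilon)\rceil\}$, $\epsilon_k:=H/2^k$. **Algorithm.** The oracle, called on $(s,a)$, returns an independent sample from $p(\cdot|s,a)$. Start with $u_t^{(0)}\equiv0$ and an arbitrary deterministic policy $\pi^{(0)}$; throughout $u^{(k)}_{H+1}\equiv0$. For $k=1,\dots,K$ put $$m_k=\Big\lceil\tfrac{128H^3}{\min\{\epsilon_k^2,1\}}\ln\tfrac{16H|\mathcal S_n|AK}{\delta}\Big\rceil,\quad \ell_k=\Big\lceil512H^2\ln\tfrac{4H|\mathcal S_n|AK}{\delta}\Big\rceil,\quad \theta_k=\tfrac1{m_k}\ln\tfrac{16H|\mathcal S_n|AK}{\delta}.$$ For each $(s,a)\in\mathcal S_n\times\mathcal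 A$ draw $m_k$ samples $x^{(i)}_{s,a}$ from $p(\cdot|s,a)$. With $\widetilde\mu_t(s,a)$ and $\widetilde\sigma_t(s,a)$ the empirical mean and the empirical variance of $u_t^{(k-1)}$ over these samples, put $$\widehat\mu^{(k)}_t(s,a)=\widetilde\mu_t(s,a)-\sqrt{2\theta_k\widetilde\sigma_t(s,a)}-\big(\tfrac23\theta_k+2(2\theta_k)^{3/4}+\eta\big)H .$$ For $t=H,H-1,\dots,1$: for each $(s,a)$ draw $\ell_k$ fresh samples $\bar x^{(i)}_{s,a}$ from $p(\cdot|s,a)$ and put $$\widehat\beta^{(k)}_{t+1}(s,a)=\tfrac1{\ell_k}\sum_{i=1}^{\ell_k}\big(u^{(k)}_{t+1}-u^{(k-1)}_{t+1}\big)(\bar x^{(i)}_{s,a})-\tfrac{\epsilon_k}{4H}-\tfrac32\eta H ;$$ then for each $s\in\mathcal S_n$ let $f(a)=r(s,a)+\widehat\mu^{(k)}_{t+1}(s,a)+\widehat\beta^{(k)}_{t+1}(s,a)$ and $c=\max_a f(a)-\eta$. For all $x$ with $Q(x)=s$: if $c\le u^{(k-1)}_t(s)$, set $u^{(k)}_t(x)=u^{(k-1)}_t(x)$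 and $\pi^{(k)}_t(x)=\pi^{(k-1)}_t(x)$; otherwise set $u_t^{(k)}(x)=c$ and $\pi_t^{(k)}(x)\in\arg\max_a f(a)$ (ties broken by any fixed rule). Return $\pi^{(K)}$. **Theorem.** There is a universal constant $C>0$ such that the following holds in every such setting with $Ln^{-\alpha}\le\frac1{16H}$. The functions $u_t^{(k)}$ are always bounded and measurable and the $\pi^{(k)}$ are deterministic policies, and with probability at least $1-\delta$: $$V_t^*(x)-\epsilon_k-12Ln^{-\alpha}H^2\le u_t^{(k)}(x)\le V_t^{\pi^{(k)}}(x)\le V_t^*(x)\qquad\forall (x,t,k)\in\mathcal X\times[H]\times[K],$$ and $V_1^*(x)-\varepsilon-12Ln^{-\alpha}H^2\le V_1^{\pi^{(K)}}(x)\le V_1^*(x)$ for all $x\in\mathcal X$, so that $\pi^{(K)}$ is $(\varepsilon+12Ln^{-\alpha}H^2)$-optimal. The number $N$ of oracle calls satisfies, for all $\varepsilon\le H/8$, $$N\le C\,H^3|\mathcal S_n|A\Big(\frac1{\varepsilon^2}+\log\frac H\varepsilon\Big)\log\Big(\frac{H|\mathcal S_n|A}{\delta}\log\frac H\varepsilon\Big),$$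 and, if moreover $\varepsilon^2\log\frac H\varepsilon\le1$, $$N\le C\,\frac{H^3|\mathcal S_n|A}{\varepsilon^2}\log\Big(\frac{H|\mathcal S_n|A}{\delta}\log\frac H\varepsilon\Big).$$ -/

import Mathlib

open MeasureTheory ProbabilityTheory

noncomputable section

/-! ### Finite-horizon Markov decision processes -/

/-- A finite-horizon MDP with state space `X` and action space `A`: horizon `H ≥ 1`, measurable
rewards in `[0, 1]` and a (time-independent) stochastic kernel of transition probabilities. -/
structure MDP (X A : Type*) [MeasurableSpace X] [MeasurableSpace A] where
  H : ℕ
  one_le_H : 1 ≤ H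
  r : X → A → ℝ
  measurable_r : Measurable (Function.uncurry r)
  r_mem : ∀ x a, r x a ∈ Set.Icc (0 : ℝ) 1
  p : Kernel (X × A) X
  markov_p : IsMarkovKernel p

/-- A randomised Markovian policy: a sequence of stochastic kernels on `A` given `X`. Time steps
are natural numbers; only the steps `1, …, H` matter. -/
structure Policy (X A : Type*) [MeasurableSpace X] [MeasurableSpace A] where
  rule : ℕ → Kernel X A
  markov_rule : ∀ t, IsMarkovKernel (rule t)

/-- The deterministic policy given by measurable decision rules `d t : X → A`. -/
def Policy.det {X A : Type*} [MeasurableSpace X] [MeasurableSpace A]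
    (d : ℕ → X → A) (hd : ∀ t, Measurable (d t)) : Policy X A where
  rule t := Kernel.deterministic (d t) (hd t)
  markov_rule t := Kernel.isMarkovKernel_deterministic (hd t)

namespace MDP

variable {X A : Type*} [MeasurableSpace X] [MeasurableSpace A]

/-- Law of the state-action trajectory `((x_t, a_t), …, (x_{t+j-1}, a_{t+j-1}))` of length `j`
under the policy `π`, started at time `t` in the state `x_t = x` (the kernel's argument):
`a_t ∼ π_t(· | x_t)`, `x_{t+1} ∼ p(· | x_t, a_t)`, and so on. -/
def trajLaw (M : MDP X A) (π : Policy X A) : (j t : ℕ) → Kernel X (Fin j → X × A)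
  | 0, _ => Kernel.const X (Measure.dirac Fin.elim0)
  | j + 1, t =>
      ((Kernel.id ×ₖ π.rule t) ⊗ₖ Kernel.prodMkLeft X (trajLaw M π j (t + 1) ∘ₖ M.p)).map
        (fun q => (Fin.cons q.1 q.2 : Fin (j + 1) → X × A))

/-- Value function `V_t^π(x)`: the expected total reward collected at the steps `t, …, H`. -/
def value (M : MDP X A) (π : Policy X A) (t : ℕ) (x : X) : ℝ :=
  ∫ ω, ∑ i, M.r (ω i).1 (ω i).2 ∂(M.trajLaw π (M.H + 1 - t) t x)

/-- Optimal value `V_t^*(x)`: supremum over all randomised Markovian policies. -/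
def optValue (M : MDP X A) (t : ℕ) (x : X) : ℝ :=
  ⨆ π : Policy X A, M.value π t x

/-- `π` is `e`-optimal. -/
def IsOptimalUpTo (M : MDP X A) (e : ℝ) (π : Policy X A) : Prop :=
  ∀ (x : X) (π' : Policy X A), M.value π' 1 x - e ≤ M.value π 1 x

end MDP

/-- Total variation distance `sup_B |μ(B) - ν(B)|` over measurable sets `B`. -/
def tvDist {X : Type*} [MeasurableSpace X] (μ ν : Measure X) : ℝ :=
  ⨆ B : {B : Set X // MeasurableSet B}, |μ.real B - ν.real B|

/-- Hölder continuity of the rewards and of the transition probabilities, constants `L` and `α`. -/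
def MDP.IsHolder {X A : Type*} [MetricSpace X] [MeasurableSpace X] [MeasurableSpace A]
    (M : MDP X A) (L α : ℝ) : Prop :=
  0 ≤ L ∧ 0 ≤ α ∧
  (∀ x x' a, |M.r x a - M.r x' a| ≤ L * dist x x' ^ α) ∧
  (∀ x x' a, tvDist (M.p (x, a)) (M.p (x', a)) ≤ L * dist x x' ^ α)

/-- `S` is a `1/n`-net. -/
def IsNet {X : Type*} [MetricSpace X] (S : Finset X) (n : ℕ) : Prop :=
  ∀ x : X, ∃ s ∈ S, dist x s ≤ 1 / (n : ℝ)

/-- `Q` is a measurable nearest-neighbour map onto `S`; the cell of `s` is `{x | Q x = s}`. -/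
def IsQuantizer {X : Type*} [MetricSpace X] [MeasurableSpace X] (S : Finset X) (Q : X → S) :
    Prop :=
  Measurable Q ∧ ∀ x, ∀ s ∈ S, dist x (Q x : X) ≤ dist x s

/-! ### The variance-reduced monotone backward induction -/

/-- What the algorithm is given besides `H` and the known rewards: the net and its quantizer, a
tie-breaking rule `argmax` for maxima over actions, an arbitrary initial policy, the accuracy `ε`,
the failure probability `δ`, and the discretization parameters `L`, `n`, `α`. -/
structure SolverInput (X A : Type*) where
  S : Finset X
  Q : X → S
  argmax : (A → ℝ) → A
  π₀ : ℕ → X → A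
  ε : ℝ
  δ : ℝ
  L : ℝ
  n : ℕ
  α : ℝ

/-- Empirical mean of `u` over a batch of samples. -/
def empMean {X : Type*} {m : ℕ} (u : X → ℝ) (xs : Fin m → X) : ℝ :=
  (∑ i, u (xs i)) / m

/-- Empirical variance of `u` over a batch of samples. -/
def empVar {X : Type*} {m : ℕ} (u : X → ℝ) (xs : Fin m → X) : ℝ :=
  empMean (fun x => u x ^ 2) xs - empMean u xs ^ 2

namespace SolverInput

variable {X A : Type*}

/-- The discretization error `L n^{-α}`. -/
def disc (I : SolverInput X A) : ℝ := I.L * (I.n : ℝ) ^ (-I.α)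

/-- Number of epochs `K = ⌈log₂ (H / ε)⌉` (none if `ε ≥ H`). -/
def K (I : SolverInput X A) (H : ℕ) : ℕ := ⌈Real.logb 2 ((H : ℝ) / I.ε)⌉₊

/-- Target accuracy `ϵ_k = H / 2^k` of epoch `k`. -/
def eps (H k : ℕ) : ℝ := (H : ℝ) / 2 ^ k

section

variable [Fintype A] (I : SolverInput X A) (H : ℕ)

/-- `ln (16 H |S_n| A K / δ)`. -/
def logTerm : ℝ :=
  Real.log (16 * H * I.S.card * Fintype.card A * I.K H / I.δ)

/-- Size `m_k` of the batch drawn for each `(s, a)` at the beginning of epoch `k`. -/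
def m (k : ℕ) : ℕ := ⌈128 * (H : ℝ) ^ 3 / min (eps H k ^ 2) 1 * I.logTerm H⌉₊

/-- Size `ℓ_k` of the fresh batch drawn for each `(s, a)` at each time step of epoch `k`
(the same for all `k`). -/
def l : ℕ :=
  ⌈512 * (H : ℝ) ^ 2 * Real.log (4 * H * I.S.card * Fintype.card A * I.K H / I.δ)⌉₊

/-- `θ_k`. -/
def θ (k : ℕ) : ℝ := I.logTerm H / I.m H k

/-- `μ̂_t^{(k)}(s, a)` as a function of `u = u_t^{(k-1)}` and the batch `xs` of samples from
`p(· | s, a)`. -/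
def muHat (k : ℕ) (u : X → ℝ) (xs : Fin (I.m H k) → X) : ℝ :=
  empMean u xs - √(2 * I.θ H k * empVar u xs)
    - (2 / 3 * I.θ H k + 2 * (2 * I.θ H k) ^ (3 / 4 : ℝ) + I.disc) * H

/-- `β̂_t^{(k)}(s, a)` as a function of `u = u_t^{(k)}`, `v = u_t^{(k-1)}` and the fresh batch `ys`
of samples from `p(· | s, a)`. -/
def betaHat (k : ℕ) (u v : X → ℝ) (ys : Fin (I.l H) → X) : ℝ :=
  empMean (fun x => u x - v x) ys - eps H k / (4 * H) - 3 / 2 * I.disc * H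

/-- The batches drawn at the beginning of epoch `k`. -/
abbrev Batch (k : ℕ) : Type _ := I.S → A → Fin (I.m H k) → X

/-- The fresh batches drawn in an epoch, one family for each time step `t ∈ {1, …, H}`. -/
abbrev FreshBatch : Type _ := Finset.Icc 1 H → I.S → A → Fin (I.l H) → X

variable (r : X → A → ℝ)

/-- `a ↦ r(s, a) + μ̂_{t+1}^{(k)}(s, a) + β̂_{t+1}^{(k)}(s, a)`, where `v = u_{t+1}^{(k-1)}`
and `u = u_{t+1}^{(k)}`. -/
def score (k : ℕ) (u v : X → ℝ) (s : I.S) (xs : A → Fin (I.m H k) → X)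
    (ys : A → Fin (I.l H) → X) (a : A) : ℝ :=
  r s a + I.muHat H k v (xs a) + I.betaHat H k u v (ys a)

/-- The functions `u_t^{(k)}` obtained from `v t = u_t^{(k-1)}` by the backward iteration
`t = H, …, 1` of epoch `k`, started from `u_{H+1}^{(k)} = 0`. -/
def epochValue (k : ℕ) (v : ℕ → X → ℝ) (xs : I.Batch H k) (ys : I.FreshBatch H)
    (t : ℕ) : X → ℝ :=
  if ht : t ∈ Finset.Icc 1 H then
    let u := epochValue k v xs ys (t + 1)
    fun x =>
      let s := I.Q x
      let c := (⨆ a, I.score H r k u (v (t + 1)) s (xs s) (ys ⟨t, ht⟩ s) a) - I.disc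
      if c ≤ v t s then v t x else c
  else 0
termination_by H + 1 - t
decreasing_by
  have := Finset.mem_Icc.mp ht
  omega

/-- The decision rules `π_t^{(k)}` obtained in epoch `k` from `v t = u_t^{(k-1)}` and
`d t = π_t^{(k-1)}`. -/
def epochPolicy (k : ℕ) (v : ℕ → X → ℝ) (d : ℕ → X → A) (xs : I.Batch H k)
    (ys : I.FreshBatch H) (t : ℕ) : X → A :=
  if ht : t ∈ Finset.Icc 1 H then
    let u := I.epochValue H r k v xs ys (t + 1)
    fun x =>
      let s := I.Q x
      let f := I.score H r k u (v (t + 1)) s (xs s) (ys ⟨t, ht⟩ s)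
      if (⨆ a, f a) - I.disc ≤ v t s then d t x else I.argmax f
  else d t

/-- The calls to the sampling oracle made by the algorithm: `m_k` calls for each epoch `k` and each
`(s, a)` in the initial batches, and `ℓ_k` calls for each epoch `k`, time step `t` and `(s, a)`. -/
abbrev Call : Type _ :=
  (Σ k : Finset.Icc 1 (I.K H), I.S × A × Fin (I.m H k)) ⊕
    (Finset.Icc 1 (I.K H) × Finset.Icc 1 H × I.S × A × Fin (I.l H))

/-- The state-action pair on which the oracle is called. -/
def callInput : I.Call H → X × A
  | Sum.inl ⟨_, s, a, _⟩ => (s, a)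
  | Sum.inr (_, _, s, a, _) => (s, a)

/-- The number of calls to the sampling oracle. -/
def numCalls : ℕ := Fintype.card (I.Call H)

/-- Joint law of the oracle's answers: they are independent, and the answer to a call on `(s, a)`
has law `p(· | s, a)`. -/
def answerLaw [MeasurableSpace X] [MeasurableSpace A] (p : Kernel (X × A) X) :
    Measure (I.Call H → X) :=
  Measure.pi fun c => p (I.callInput H c)

/-- Functions and decision rules `(u^{(k)}, π^{(k)})` after `k` epochs, computed from the
oracle's answers `ω`. -/
def run (ω : I.Call H → X) : ℕ → (ℕ → X → ℝ) × (ℕ → X → A)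
  | 0 => (0, I.π₀)
  | k + 1 =>
      let prev := run ω k
      if hk : k + 1 ∈ Finset.Icc 1 (I.K H) then
        let xs : I.Batch H (k + 1) := fun s a i => ω (Sum.inl ⟨⟨k + 1, hk⟩, s, a, i⟩)
        let ys : I.FreshBatch H := fun t s a i => ω (Sum.inr (⟨k + 1, hk⟩, t, s, a, i))
        (I.epochValue H r (k + 1) prev.1 xs ys, I.epochPolicy H r (k + 1) prev.1 prev.2 xs ys)
      else prev

/-- `u_t^{(k)}(x)`. -/
def u (ω : I.Call H → X) (k t : ℕ) (x : X) : ℝ := (I.run H r ω k).1 t x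

/-- `π_t^{(k)}(x)`. -/
def pol (ω : I.Call H → X) (k t : ℕ) (x : X) : A := (I.run H r ω k).2 t x

end

end SolverInput

end

/-! ### Concentration of empirical means and variances -/

section Concentration

variable {X : Type*}

/-! Let W denote the solution of the Bellman optimality equation. After every epoch the computed
function u should satisfy two properties (`EpochInvariant`): it is a subsolution of the Bellman
equations of its own policy, and it is at most ε_k + 12ηH² below W. Monotonicity of the lookahead
turns the first property into u ≤ V^π (`EpochInvariant.u_le_value`). Since V* ≤ W, the second yields
the lower bound.

The subsolution property is qualitative. Scores are lowered by their confidence radii and by the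
discretization error. An updated cell therefore satisfies the inequality by accuracy of the
estimates. A cell left alone inherits it from the previous epoch, because the iterates increase with
k (`EpochInvariant.succ_subsolution`).

The lower bound explains the sample size. The integral of the new iterate is that of the old iterate
plus that of the increment. The increment has range of order ε_k + ηH², so about H² log samples
suffice for an error of that order divided by H, even if they are redrawn at each time step. The old
iterate is estimated once per epoch, with a Bernstein radius governed by its standard deviation,
which is close to that of W (`confidence_radius_le`). Bounding each of the H radii by its worst case
would be too expensive. Instead, the arithmetic-geometric mean inequality replaces a radius by λ
Var(W) + O(ε_k/H + ηH), and the potential λ W(j - W), with j steps to go, absorbs the variances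
along the backward recursion while staying below ε_k/16 (`EpochInvariant.succ_error`).

The randomness is confined to the event `AllAccurate`. The function averaged over a batch does not
depend on that batch, so resampling the batch reduces each failure to a concentration inequality for
a fixed function (`pi_le_of_resample`). The range conditions required there are premises of the
accuracy statements, so the union bound needs no conditioning on earlier success. On `AllAccurate`
the rest is a deterministic double induction, over epochs and backwards in time. -/

lemma empMean_sub_const {m : ℕ} (hm : 0 < m) (g : X → ℝ) (c : ℝ) (xs : Fin m → X) :
    empMean (fun x => g x - c) xs = empMean g xs - c := by
  have : (m : ℝ) ≠ 0 := by exact_mod_cast hm.ne'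
  simp only [empMean, Finset.sum_sub_distrib, Finset.sum_const, Finset.card_univ,
    Fintype.card_fin, nsmul_eq_mul]
  field_simp

lemma empMean_const_sub {m : ℕ} (hm : 0 < m) (g : X → ℝ) (c : ℝ) (xs : Fin m → X) :
    empMean (fun x => c - g x) xs = c - empMean g xs := by
  have : (m : ℝ) ≠ 0 := by exact_mod_cast hm.ne'
  simp only [empMean, Finset.sum_sub_distrib, Finset.sum_const, Finset.card_univ,
    Fintype.card_fin, nsmul_eq_mul]
  field_simp

lemma empMean_mem_Icc {m : ℕ} (hm : 0 < m) {g : X → ℝ} {a b : ℝ} (hg : ∀ x, g x ∈ Set.Icc a b)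
    (xs : Fin m → X) : empMean g xs ∈ Set.Icc a b := by
  have hm' : (0 : ℝ) < m := by exact_mod_cast hm
  rw [empMean, Set.mem_Icc, le_div_iff₀ hm', div_le_iff₀ hm']
  constructor
  · calc a * m = ∑ _i : Fin m, a := by simp [mul_comm]
      _ ≤ _ := Finset.sum_le_sum fun i _ => (hg _).1
  · calc _ ≤ ∑ _i : Fin m, b := Finset.sum_le_sum fun i _ => (hg _).2
      _ = b * m := by simp [mul_comm]

lemma abs_sqrt_sub_sqrt_le {x y : ℝ} (hx : 0 ≤ x) (hy : 0 ≤ y) : |√x - √y| ≤ √|x - y| := by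
  apply Real.le_sqrt_of_sq_le
  rw [sq_abs]
  have h1 := Real.sq_sqrt hx
  have h2 := Real.sq_sqrt hy
  have h3 := Real.sqrt_nonneg x
  have h4 := Real.sqrt_nonneg y
  rcases le_total x y with h | h
  · rw [abs_sub_comm, abs_of_nonneg (by linarith)]
    have := Real.sqrt_le_sqrt h
    nlinarith
  · rw [abs_of_nonneg (by linarith)]
    have := Real.sqrt_le_sqrt h
    nlinarith

lemma empVar_nonneg {m : ℕ} (hm : 0 < m) (v : X → ℝ) (xs : Fin m → X) : 0 ≤ empVar v xs := by
  have hm' : (0 : ℝ) < m := by exact_mod_cast hm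
  rw [empVar, empMean, empMean, div_pow, sub_nonneg, div_le_div_iff₀ (by positivity) hm']
  have := sq_sum_le_card_mul_sum_sq (s := Finset.univ) (f := fun i => v (xs i))
  simp only [Finset.card_univ, Fintype.card_fin] at this
  nlinarith

variable [MeasurableSpace X]

lemma integrable_of_bounded {ν : Measure X} [IsProbabilityMeasure ν] {g : X → ℝ}
    (hg : Measurable g) {B : ℝ} (hB : ∀ x, |g x| ≤ B) : Integrable g ν :=
  Integrable.of_bound hg.aestronglyMeasurable B (ae_of_all _ hB)

lemma integrable_of_Icc {ν : Measure X} [IsProbabilityMeasure ν] {g : X → ℝ}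
    (hg : Measurable g) {a b : ℝ} (hB : ∀ x, g x ∈ Set.Icc a b) : Integrable g ν :=
  Integrable.of_mem_Icc a b hg.aemeasurable (ae_of_all _ hB)

lemma integral_mem_Icc_of_mem_Icc {ν : Measure X} [IsProbabilityMeasure ν] {g : X → ℝ}
    (hg : Measurable g) {a b : ℝ} (hB : ∀ x, g x ∈ Set.Icc a b) :
    ∫ x, g x ∂ν ∈ Set.Icc a b := by
  have hi := integrable_of_Icc (ν := ν) hg hB
  constructor
  · simpa using integral_mono (integrable_const a) hi (fun x => (hB x).1)
  · simpa using integral_mono hi (integrable_const b) (fun x => (hB x).2)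

/-- Chernoff bound for the empirical mean of independent samples. -/
lemma measureReal_pi_lt_empMean_le (ν : Measure X) [IsProbabilityMeasure ν] {m : ℕ} (hm : 0 < m)
    {g : X → ℝ} {lam c y : ℝ} (hlam : 0 ≤ lam)
    (hint : Integrable (fun x => Real.exp (lam * g x)) ν)
    (hc : ∫ x, Real.exp (lam * g x) ∂ν ≤ Real.exp c) :
    (Measure.pi fun _ : Fin m => ν).real {xs | y < empMean g xs}
      ≤ Real.exp (-(m * (lam * y - c))) := by
  have hm' : (0 : ℝ) < m := by exact_mod_cast hm
  have hprod : ∀ xs : Fin m → X, Real.exp (lam * ∑ i, g (xs i))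
      = ∏ i, Real.exp (lam * g (xs i)) := by
    intro xs
    rw [Finset.mul_sum, Real.exp_sum]
  have hI : Integrable (fun xs : Fin m → X => Real.exp (lam * ∑ i, g (xs i)))
      (Measure.pi fun _ : Fin m => ν) := by
    simp_rw [hprod]
    exact Integrable.fintype_prod (f := fun _ x => Real.exp (lam * g x)) (fun _ => hint)
  have h1 := measure_ge_le_exp_mul_mgf (μ := Measure.pi fun _ : Fin m => ν)
    (X := fun xs => ∑ i, g (xs i)) (m * y) hlam hI
  have h2 : mgf (fun xs : Fin m → X => ∑ i, g (xs i)) (Measure.pi fun _ : Fin m => ν) lam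
      ≤ Real.exp (m * c) := by
    rw [mgf]
    simp_rw [hprod]
    rw [integral_fintype_prod_eq_pow (fun x => Real.exp (lam * g x)), Fintype.card_fin,
      Real.exp_nat_mul]
    exact pow_le_pow_left₀ (integral_nonneg fun _ => (Real.exp_pos _).le) hc m
  calc _ ≤ (Measure.pi fun _ : Fin m => ν).real {xs | m * y ≤ ∑ i, g (xs i)} := by
        apply measureReal_mono _ (measure_ne_top _ _)
        intro xs hxs
        simp only [Set.mem_ofPred_eq, empMean] at hxs ⊢
        rw [lt_div_iff₀ hm'] at hxs
        linarith
    _ ≤ Real.exp (-lam * (m * y)) * Real.exp (m * c) :=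
        h1.trans (mul_le_mul_of_nonneg_left h2 (Real.exp_pos _).le)
    _ = _ := by rw [← Real.exp_add]; congr 1; ring

/-- One-sided Hoeffding inequality. -/
lemma hoeffding_upper (ν : Measure X) [IsProbabilityMeasure ν] {m : ℕ} (hm : 0 < m)
    {g : X → ℝ} (hg : Measurable g) {a b : ℝ} (hab : ∀ x, g x ∈ Set.Icc a b)
    {y lam : ℝ} (hy : 0 ≤ y) (hlam : lam * (b - a) ^ 2 ≤ 2 * m * y ^ 2) (hlt : a < b) :
    (Measure.pi fun _ : Fin m => ν).real {xs | y < empMean g xs - ∫ x, g x ∂ν}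
      ≤ Real.exp (-lam) := by
  have hs := hasSubgaussianMGF_of_mem_Icc (μ := ν) hg.aemeasurable (ae_of_all _ hab)
  have hba : 0 < b - a := sub_pos.2 hlt
  -- The minimiser of the Chernoff exponent for a subgaussian variable with parameter (b - a)²/4.
  set t : ℝ := 4 * y / (b - a) ^ 2 with ht
  have ht0 : 0 ≤ t := by positivity
  have hc := hs.mgf_le t
  have hn : (((‖b - a‖₊ / 2) ^ 2 : NNReal) : ℝ) = ((b - a) / 2) ^ 2 := by
    simp [abs_of_pos hba]
  rw [hn, mgf] at hc
  have := measureReal_pi_lt_empMean_le ν hm (y := y) ht0 (hs.integrable_exp_mul t) hc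
  simp_rw [empMean_sub_const hm] at this
  refine this.trans (Real.exp_le_exp.2 (neg_le_neg ?_))
  have e : (m : ℝ) * (t * y - ((b - a) / 2) ^ 2 * t ^ 2 / 2) = 2 * m * y ^ 2 / (b - a) ^ 2 := by
    rw [ht]; field_simp; ring
  rw [e, le_div_iff₀ (by positivity)]
  exact hlam

lemma measureReal_lt_abs_le {Ω : Type*} [MeasurableSpace Ω] (μ : Measure Ω)
    [IsProbabilityMeasure μ] (f : Ω → ℝ) {y c : ℝ}
    (h1 : μ.real {ω | y < f ω} ≤ c) (h2 : μ.real {ω | y < -f ω} ≤ c) :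
    μ.real {ω | y < |f ω|} ≤ 2 * c := by
  have : {ω | y < |f ω|} = {ω | y < f ω} ∪ {ω | y < -f ω} := by
    ext ω; simp [lt_abs]
  rw [this]
  linarith [measureReal_union_le (μ := μ) {ω | y < f ω} {ω | y < -f ω}]

/-- Two-sided Hoeffding inequality. -/
lemma hoeffding_abs (ν : Measure X) [IsProbabilityMeasure ν] {m : ℕ} (hm : 0 < m)
    {g : X → ℝ} (hg : Measurable g) {a b : ℝ} (hab : ∀ x, g x ∈ Set.Icc a b)
    {y lam : ℝ} (hy : 0 ≤ y) (hlam : lam * (b - a) ^ 2 ≤ 2 * m * y ^ 2) (hlt : a < b) :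
    (Measure.pi fun _ : Fin m => ν).real {xs | y < |empMean g xs - ∫ x, g x ∂ν|}
      ≤ 2 * Real.exp (-lam) := by
  refine measureReal_lt_abs_le _ _ (hoeffding_upper ν hm hg hab hy hlam hlt) ?_
  have h := hoeffding_upper ν hm (g := fun x => b - g x) (hg.const_sub b) (a := 0) (b := b - a)
    (fun x => ⟨by linarith [(hab x).2], by linarith [(hab x).1]⟩) hy (by simpa using hlam)
    (by linarith)
  rw [integral_sub (integrable_const _) (integrable_of_Icc hg hab)] at h
  simp_rw [empMean_const_sub hm] at h
  convert h using 4
  simp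

/-- For a nonnegative argument the tail of the exponential series is dominated by a geometric series
of ratio z/3, because (j+2)! ≥ 2·3^j. For negative x already exp x ≤ 1 + x + x²/2, since (1 + x +
x²/2)(1 - x + x²/2) = 1 + x⁴/4 ≥ 1 and the second factor is at most exp(-x). -/
lemma exp_le_one_add_add_sq_div {x c : ℝ} (hxc : x ≤ c) (hc0 : 0 ≤ c) (hc : c < 3) :
    Real.exp x ≤ 1 + x + x ^ 2 / (2 * (1 - c / 3)) := by
  have hcp : 0 < 1 - c / 3 := by linarith
  have key : ∀ z : ℝ, 0 ≤ z → z < 3 → Real.exp z ≤ 1 + z + z ^ 2 / (2 * (1 - z / 3)) := by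
    intro z hz hz3
    have h1 := NormedSpace.expSeries_div_hasSum_exp (𝔸 := ℝ) z
    rw [← Real.exp_eq_exp_ℝ] at h1
    have h2 := (hasSum_nat_add_iff' 2).2 h1
    have h3 : HasSum (fun j : ℕ => z ^ 2 / 2 * (z / 3) ^ j) (z ^ 2 / 2 * (1 - z / 3)⁻¹) :=
      (hasSum_geometric_of_lt_one (by positivity) (by linarith)).mul_left _
    have h4 := hasSum_le (fun j => ?_) h2 h3
    · simp only [Finset.sum_range_succ, Finset.sum_range_zero, pow_zero, Nat.factorial, pow_one,
        Nat.cast_one, div_one, zero_add, mul_one] at h4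
      rw [div_mul_eq_div_div, div_eq_mul_inv _ (1 - z / 3)]
      linarith
    · have hf : ((2 : ℝ) * 3 ^ j) ≤ ((j + 2).factorial : ℝ) := by
        have := Nat.factorial_mul_pow_le_factorial (n := j) (m := 2)
        rw [Nat.add_comm]
        exact_mod_cast this
      have : z ^ 2 / 2 * (z / 3) ^ j = z ^ (j + 2) / (2 * 3 ^ j) := by
        rw [div_pow]; field_simp; ring
      rw [this]
      gcongr
  have hmono : ∀ z : ℝ, 0 ≤ z → z ≤ c →
      x ^ 2 / (2 * (1 - z / 3)) ≤ x ^ 2 / (2 * (1 - c / 3)) := by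
    intro z _ hzc
    gcongr
  rcases le_total 0 x with hx | hx
  · have := key x hx (by linarith)
    have := hmono x hx hxc
    linarith
  · have h0 := hmono 0 le_rfl hc0
    have : Real.exp x ≤ 1 + x + x ^ 2 / 2 := by
      have h5 := Real.quadratic_le_exp_of_nonneg (x := -x) (by linarith)
      have h6 : Real.exp x * Real.exp (-x) = 1 := by rw [← Real.exp_add]; simp
      have hq : 0 < 1 + x + x ^ 2 / 2 := by nlinarith [sq_nonneg (x + 1)]
      by_contra! hcon
      have : (1 + x + x ^ 2 / 2) * (1 + -x + (-x) ^ 2 / 2) < Real.exp x * Real.exp (-x) :=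
        mul_lt_mul hcon h5 (by nlinarith [sq_nonneg (x - 1)]) (Real.exp_pos _).le
      rw [h6] at this
      nlinarith [sq_nonneg (x ^ 2)]
    norm_num at h0
    linarith

/-- Moment generating function of a centred variable bounded from above. -/
lemma integral_exp_mul_le_bernstein (ν : Measure X) [IsProbabilityMeasure ν] {g : X → ℝ}
    (hg : Measurable g) {b : ℝ} (hb0 : 0 ≤ b) (hb : ∀ x, |g x| ≤ b) (h0 : ∫ x, g x ∂ν = 0)
    {lam : ℝ} (hlam : 0 ≤ lam) (hlb : lam * b < 3) :
    ∫ x, Real.exp (lam * g x) ∂ν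
      ≤ Real.exp (lam ^ 2 * (∫ x, g x ^ 2 ∂ν) / (2 * (1 - lam * b / 3))) := by
  have hsq : ∀ x, |g x ^ 2| ≤ b ^ 2 := fun x => by
    rw [abs_pow]; exact pow_le_pow_left₀ (abs_nonneg _) (hb x) 2
  have hg1 : Integrable g ν := integrable_of_bounded hg hb
  have hg2 : Integrable (fun x => g x ^ 2) ν := integrable_of_bounded (hg.pow_const 2) hsq
  have hle : ∀ x, lam * g x ≤ lam * b := fun x =>
    mul_le_mul_of_nonneg_left ((le_abs_self _).trans (hb x)) hlam
  have hexp : Integrable (fun x => Real.exp (lam * g x)) ν := by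
    refine integrable_of_bounded (by fun_prop) (B := Real.exp (lam * b)) fun x => ?_
    rw [abs_of_pos (Real.exp_pos _)]
    exact Real.exp_le_exp.2 (hle x)
  have hlin : Integrable (fun x => 1 + lam * g x) ν := (integrable_const _).add (hg1.const_mul _)
  set d := 2 * (1 - lam * b / 3) with hd
  calc _ ≤ ∫ x, (1 + lam * g x + lam ^ 2 / d * g x ^ 2) ∂ν := by
        refine integral_mono hexp (hlin.add (hg2.const_mul _)) fun x => ?_
        have := exp_le_one_add_add_sq_div (hle x) (by positivity) hlb
        simp only
        calc _ ≤ _ := this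
          _ = _ := by rw [← hd]; ring
    _ = 1 + lam ^ 2 * (∫ x, g x ^ 2 ∂ν) / d := by
        rw [integral_add hlin (hg2.const_mul _),
          integral_add (integrable_const _) (hg1.const_mul _), integral_const_mul,
          integral_const_mul, h0]
        simp; ring
    _ ≤ _ := by linarith [Real.add_one_le_exp (lam ^ 2 * (∫ x, g x ^ 2 ∂ν) / d)]

/-- One-sided Bernstein inequality. -/
lemma bernstein_upper (ν : Measure X) [IsProbabilityMeasure ν] {m : ℕ} (hm : 0 < m)
    {g : X → ℝ} (hg : Measurable g) {b : ℝ} (hb0 : 0 < b) (hb : ∀ x, |g x| ≤ b)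
    (h0 : ∫ x, g x ∂ν = 0) {θ : ℝ} (hθ : 0 < θ) :
    (Measure.pi fun _ : Fin m => ν).real
      {xs | √(2 * θ * ∫ x, g x ^ 2 ∂ν) + 2 / 3 * θ * b < empMean g xs}
      ≤ Real.exp (-(m * θ)) := by
  set σ := ∫ x, g x ^ 2 ∂ν with hσ
  have hσ0 : 0 ≤ σ := integral_nonneg fun x => sq_nonneg _
  set S := √(2 * θ * σ) with hS
  have hS0 : 0 ≤ S := Real.sqrt_nonneg _
  have hS2 : S ^ 2 = 2 * θ * σ := Real.sq_sqrt (by positivity)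
  have hD : 0 < S + 4 / 3 * θ * b := by positivity
  set D := S + 4 / 3 * θ * b with hDdef
  -- Not the optimal parameter, but one for which 1 - lam·b/3 is exactly the deviation S + 2θb/3
  -- divided by D. The final inequality then holds with slack 2θbS/3.
  set lam := 2 * θ / D with hlam
  have hlam0 : 0 ≤ lam := by positivity
  have hy : 0 < S + 2 / 3 * θ * b := by positivity
  have hlb : lam * b < 3 := by
    rw [hlam, div_mul_eq_mul_div, div_lt_iff₀ hD, hDdef]
    nlinarith [mul_pos hθ hb0]
  have hc := integral_exp_mul_le_bernstein ν hg hb0.le hb h0 hlam0 hlb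
  have hexp : Integrable (fun x => Real.exp (lam * g x)) ν := by
    refine integrable_of_bounded (by fun_prop) (B := Real.exp (lam * b)) fun x => ?_
    rw [abs_of_pos (Real.exp_pos _)]
    exact Real.exp_le_exp.2 (mul_le_mul_of_nonneg_left ((le_abs_self _).trans (hb x)) hlam0)
  refine (measureReal_pi_lt_empMean_le ν hm hlam0 hexp hc).trans
    (Real.exp_le_exp.2 (neg_le_neg (mul_le_mul_of_nonneg_left ?_ (Nat.cast_nonneg _))))
  rw [← hσ]
  have e1 : 1 - lam * b / 3 = (S + 2 / 3 * θ * b) / D := by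
    rw [hlam, eq_div_iff hD.ne']
    field_simp
    rw [hDdef]; ring
  have e2 : lam ^ 2 * σ / (2 * (1 - lam * b / 3)) = θ * S ^ 2 / (D * (S + 2 / 3 * θ * b)) := by
    rw [e1, hS2, hlam]
    field_simp
    try ring
  have e3 : lam * (S + 2 / 3 * θ * b) - θ * S ^ 2 / (D * (S + 2 / 3 * θ * b))
      = θ * (2 * (S + 2 / 3 * θ * b) ^ 2 - S ^ 2) / (D * (S + 2 / 3 * θ * b)) := by
    rw [hlam]; field_simp
  rw [e2, e3, le_div_iff₀ (by positivity)]
  refine mul_le_mul_of_nonneg_left ?_ hθ.le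
  rw [hDdef]
  nlinarith [mul_nonneg hS0 (mul_pos hθ hb0).le]

/-- Variance of a function under a measure, as second moment minus squared mean. -/
noncomputable def popVar (ν : Measure X) (v : X → ℝ) : ℝ := ∫ x, v x ^ 2 ∂ν - (∫ x, v x ∂ν) ^ 2

lemma popVar_eq_integral_sq {ν : Measure X} [IsProbabilityMeasure ν] {v : X → ℝ}
    (hv : Measurable v) {B : ℝ} (hB : ∀ x, |v x| ≤ B) :
    popVar ν v = ∫ x, (v x - ∫ y, v y ∂ν) ^ 2 ∂ν := by
  have h1 : Integrable v ν := integrable_of_bounded hv hB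
  have h2 : Integrable (fun x => v x ^ 2) ν := integrable_of_bounded (hv.pow_const 2)
    (B := B ^ 2) fun x => by
      rw [abs_pow]; exact pow_le_pow_left₀ (abs_nonneg _) (hB x) 2
  set c := ∫ y, v y ∂ν with hc
  have : ∀ x, (v x - c) ^ 2 = v x ^ 2 - 2 * c * v x + c ^ 2 := fun x => by ring
  simp_rw [this]
  have h3 : Integrable (fun x => v x ^ 2 - 2 * c * v x) ν := h2.sub (h1.const_mul _)
  rw [integral_add h3 (integrable_const _), integral_sub h2 (h1.const_mul _),
    integral_const_mul, ← hc, popVar, ← hc]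
  simp; ring

lemma popVar_nonneg {ν : Measure X} [IsProbabilityMeasure ν] {v : X → ℝ}
    (hv : Measurable v) {B : ℝ} (hB : ∀ x, |v x| ≤ B) : 0 ≤ popVar ν v := by
  rw [popVar_eq_integral_sq hv hB]
  exact integral_nonneg fun x => sq_nonneg _

/-- Two-sided Bernstein inequality for a function with values in `[0, b]`. -/
lemma bernstein_abs (ν : Measure X) [IsProbabilityMeasure ν] {m : ℕ} (hm : 0 < m)
    {v : X → ℝ} (hv : Measurable v) {b : ℝ} (hb0 : 0 < b) (hb : ∀ x, v x ∈ Set.Icc 0 b)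
    {θ : ℝ} (hθ : 0 < θ) :
    (Measure.pi fun _ : Fin m => ν).real
      {xs | √(2 * θ * popVar ν v) + 2 / 3 * θ * b < |empMean v xs - ∫ x, v x ∂ν|}
      ≤ 2 * Real.exp (-(m * θ)) := by
  have hvi := integrable_of_Icc (ν := ν) hv hb
  have habs : ∀ x, |v x| ≤ b := fun x => abs_le.2 ⟨by linarith [(hb x).1], (hb x).2⟩
  have hc := integral_mem_Icc_of_mem_Icc (ν := ν) hv hb
  rw [popVar_eq_integral_sq hv habs]
  set c := ∫ x, v x ∂ν with hcdef
  refine measureReal_lt_abs_le _ _ ?_ ?_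
  · have h := bernstein_upper ν hm (g := fun x => v x - c) (hv.sub_const c) hb0
      (fun x => abs_le.2 ⟨by linarith [(hb x).1, hc.2], by linarith [(hb x).2, hc.1]⟩)
      (by rw [integral_sub hvi (integrable_const _)]; simp [hcdef]) hθ
    simpa only [empMean_sub_const hm] using h
  · have h := bernstein_upper ν hm (g := fun x => c - v x) (hv.const_sub c) hb0
      (fun x => abs_le.2 ⟨by linarith [(hb x).2, hc.1], by linarith [(hb x).1, hc.2]⟩)
      (by rw [integral_sub (integrable_const _) hvi]; simp [hcdef]) hθ
    simp only [empMean_const_sub hm] at h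
    have e : ∀ x, (c - v x) ^ 2 = (v x - c) ^ 2 := fun x => by ring
    simp_rw [e] at h
    simpa only [neg_sub] using h

/-- Concentration of the empirical variance. -/
lemma empVar_concentration (ν : Measure X) [IsProbabilityMeasure ν] {m : ℕ} (hm : 0 < m)
    {v : X → ℝ} (hv : Measurable v) {b : ℝ} (hb0 : 0 < b) (hb : ∀ x, v x ∈ Set.Icc 0 b)
    {θ : ℝ} (hθ : 0 < θ) :
    (Measure.pi fun _ : Fin m => ν).real {xs | 4 * b ^ 2 * √(2 * θ) < |empVar v xs - popVar ν v|}
      ≤ 4 * Real.exp (-(m * θ)) := by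
  have hy : (√(2 * θ)) ^ 2 = 2 * θ := Real.sq_sqrt (by positivity)
  have hy0 := Real.sqrt_nonneg (2 * θ)
  have h1 := hoeffding_abs ν hm hv hb (y := b * √(2 * θ)) (lam := m * θ) (by positivity)
    (by
      rw [mul_pow, hy]
      nlinarith [show (0:ℝ) ≤ m * θ * b ^ 2 by positivity]) hb0
  have h2 := hoeffding_abs ν hm (g := fun x => v x ^ 2) (hv.pow_const 2) (a := 0) (b := b ^ 2)
    (fun x => ⟨sq_nonneg _, pow_le_pow_left₀ (hb x).1 (hb x).2 2⟩) (y := b ^ 2 * √(2 * θ))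
    (lam := m * θ) (by positivity)
    (by
      rw [mul_pow, hy]
      nlinarith [show (0:ℝ) ≤ m * θ * b ^ 4 by positivity]) (by positivity)
  -- The second moment contributes b²√(2θ) and the squared mean 2b·b√(2θ), so 3 would do in place of
  -- 4.
  have hsub : {xs : Fin m → X | 4 * b ^ 2 * √(2 * θ) < |empVar v xs - popVar ν v|} ⊆
      {xs | b * √(2 * θ) < |empMean v xs - ∫ x, v x ∂ν|} ∪
      {xs | b ^ 2 * √(2 * θ) < |empMean (fun x => v x ^ 2) xs - ∫ x, v x ^ 2 ∂ν|} := by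
    intro xs hxs
    by_contra hcon
    simp only [Set.mem_union, Set.mem_ofPred_eq, not_or, not_lt] at hcon hxs
    obtain ⟨ha, hb'⟩ := hcon
    have hm1 := empMean_mem_Icc hm hb xs
    have hm2 := integral_mem_Icc_of_mem_Icc (ν := ν) hv hb
    rw [empVar, popVar] at hxs
    set p := empMean v xs
    set q := ∫ x, v x ∂ν
    have hpq : |p ^ 2 - q ^ 2| ≤ 2 * b * (b * √(2 * θ)) := by
      rw [sq_sub_sq, abs_mul]
      have : |p + q| ≤ 2 * b := abs_le.2 ⟨by linarith [hm1.1, hm2.1], by linarith [hm1.2, hm2.2]⟩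
      exact mul_le_mul this ha (abs_nonneg _) (by positivity)
    have : 0 ≤ b ^ 2 * √(2 * θ) := by positivity
    rw [lt_abs] at hxs
    rw [abs_le] at hb' hpq
    rcases hxs with h | h <;> nlinarith [hb'.1, hb'.2, hpq.1, hpq.2]
  have := measureReal_mono (μ := Measure.pi fun _ : Fin m => ν) hsub (measure_ne_top _ _)
  linarith [measureReal_union_le (μ := Measure.pi fun _ : Fin m => ν)
    {xs | b * √(2 * θ) < |empMean v xs - ∫ x, v x ∂ν|}
    {xs | b ^ 2 * √(2 * θ) < |empMean (fun x => v x ^ 2) xs - ∫ x, v x ^ 2 ∂ν|}]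

/-- The empirical mean, lowered by its empirical confidence radius, lies just below the mean. -/
lemma lowered_empMean_concentration (ν : Measure X) [IsProbabilityMeasure ν] {m : ℕ} (hm : 0 < m)
    {v : X → ℝ} (hv : Measurable v) {b : ℝ} (hb0 : 0 < b) (hb : ∀ x, v x ∈ Set.Icc 0 b)
    {θ : ℝ} (hθ : 0 < θ) :
    (Measure.pi fun _ : Fin m => ν).real {xs | ¬
      (empMean v xs - √(2 * θ * empVar v xs) - (2 / 3 * θ + 2 * (2 * θ) ^ (3 / 4 : ℝ)) * b
          ≤ ∫ x, v x ∂ν ∧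
        ∫ x, v x ∂ν - 2 * √(2 * θ * popVar ν v) - (4 / 3 * θ + 4 * (2 * θ) ^ (3 / 4 : ℝ)) * b
          ≤ empMean v xs - √(2 * θ * empVar v xs)
            - (2 / 3 * θ + 2 * (2 * θ) ^ (3 / 4 : ℝ)) * b)}
      ≤ 6 * Real.exp (-(m * θ)) := by
  have habs : ∀ x, |v x| ≤ b := fun x => abs_le.2 ⟨by linarith [(hb x).1], (hb x).2⟩
  have hsub : {xs : Fin m → X | ¬
      (empMean v xs - √(2 * θ * empVar v xs) - (2 / 3 * θ + 2 * (2 * θ) ^ (3 / 4 : ℝ)) * b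
          ≤ ∫ x, v x ∂ν ∧
        ∫ x, v x ∂ν - 2 * √(2 * θ * popVar ν v) - (4 / 3 * θ + 4 * (2 * θ) ^ (3 / 4 : ℝ)) * b
          ≤ empMean v xs - √(2 * θ * empVar v xs)
            - (2 / 3 * θ + 2 * (2 * θ) ^ (3 / 4 : ℝ)) * b)} ⊆
      {xs | √(2 * θ * popVar ν v) + 2 / 3 * θ * b < |empMean v xs - ∫ x, v x ∂ν|} ∪
      {xs | 4 * b ^ 2 * √(2 * θ) < |empVar v xs - popVar ν v|} := by
    intro xs hxs
    by_contra hcon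
    simp only [Set.mem_union, Set.mem_ofPred_eq, not_or, not_lt] at hcon hxs
    obtain ⟨h1, h2⟩ := hcon
    apply hxs
    -- Origin of the exponent 3/4: the variance error is of order √(2θ), and it is multiplied by 2θ
    -- before the square root is taken.
    have hsd : |√(2 * θ * empVar v xs) - √(2 * θ * popVar ν v)|
        ≤ 2 * (2 * θ) ^ (3 / 4 : ℝ) * b := by
      refine (abs_sqrt_sub_sqrt_le (mul_nonneg (by positivity) (empVar_nonneg hm v xs))
        (mul_nonneg (by positivity) (popVar_nonneg hv habs))).trans ?_
      apply Real.sqrt_le_iff.2 ⟨by positivity, ?_⟩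
      rw [← mul_sub, abs_mul, abs_of_pos (by positivity : 0 < 2 * θ)]
      have e : (2 * (2 * θ) ^ (3 / 4 : ℝ) * b) ^ 2 = 2 * θ * (4 * b ^ 2 * √(2 * θ)) := by
        have : ((2 * θ) ^ (3 / 4 : ℝ)) ^ 2 = 2 * θ * √(2 * θ) := by
          rw [Real.sqrt_eq_rpow, ← Real.rpow_natCast, ← Real.rpow_mul (by positivity)]
          nth_rewrite 2 [← Real.rpow_one (2 * θ)]
          rw [← Real.rpow_add (by positivity)]
          norm_num
        rw [mul_pow, mul_pow, this]; ring
      rw [e]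
      exact mul_le_mul_of_nonneg_left h2 (by positivity)
    rw [abs_le] at h1 hsd
    constructor <;> nlinarith [h1.1, h1.2, hsd.1, hsd.2]
  have := measureReal_mono (μ := Measure.pi fun _ : Fin m => ν) hsub (measure_ne_top _ _)
  linarith [measureReal_union_le (μ := Measure.pi fun _ : Fin m => ν)
    {xs | √(2 * θ * popVar ν v) + 2 / 3 * θ * b < |empMean v xs - ∫ x, v x ∂ν|}
    {xs | 4 * b ^ 2 * √(2 * θ) < |empVar v xs - popVar ν v|},
    bernstein_abs ν hm hv hb0 hb hθ, empVar_concentration ν hm hv hb0 hb hθ]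

end Concentration

/-! ### Total variation and integrals -/

section TotalVariation

variable {X : Type*} [MeasurableSpace X]

lemma abs_measureReal_sub_le_tvDist (μ ν : Measure X) [IsProbabilityMeasure μ]
    [IsProbabilityMeasure ν] {B : Set X} (hB : MeasurableSet B) :
    |μ.real B - ν.real B| ≤ tvDist μ ν := by
  refine le_ciSup (f := fun B : {B : Set X // MeasurableSet B} => |μ.real B - ν.real B|)
    ⟨1, ?_⟩ ⟨B, hB⟩
  rintro _ ⟨C, rfl⟩
  have h1 : μ.real (C : Set X) ≤ 1 := measureReal_le_one
  have h2 : ν.real (C : Set X) ≤ 1 := measureReal_le_one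
  have h3 : 0 ≤ μ.real (C : Set X) := measureReal_nonneg
  have h4 : 0 ≤ ν.real (C : Set X) := measureReal_nonneg
  exact abs_le.2 ⟨by linarith, by linarith⟩

/-- Integrals of functions with values in `[0, b]` differ by at most `b` times the total variation
distance. -/
lemma abs_integral_sub_le_tvDist (μ ν : Measure X) [IsProbabilityMeasure μ]
    [IsProbabilityMeasure ν] {f : X → ℝ} (hf : Measurable f) {b : ℝ} (hb : 0 ≤ b)
    (hfb : ∀ x, f x ∈ Set.Icc 0 b) :
    |∫ x, f x ∂μ - ∫ x, f x ∂ν| ≤ b * tvDist μ ν := by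
  have hint : ∀ ρ : Measure X, IsProbabilityMeasure ρ →
      IntegrableOn (fun t => ρ.real {a | t ≤ f a}) (Set.Ioc 0 b) := by
    intro ρ hρ
    refine Integrable.of_bound (Antitone.measurable ?_).aestronglyMeasurable 1
      (ae_of_all _ fun t => ?_)
    · exact fun s t hst => measureReal_mono (fun a ha => hst.trans ha) (measure_ne_top _ _)
    · rw [Real.norm_of_nonneg measureReal_nonneg]
      exact measureReal_le_one
  -- Layer cake: each superlevel set changes its mass by at most the total variation distance, and
  -- the levels fill an interval of length b.
  have hlay : ∀ ρ : Measure X, IsProbabilityMeasure ρ →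
      ∫ x, f x ∂ρ = ∫ t in Set.Ioc 0 b, ρ.real {a | t ≤ f a} := fun ρ _ =>
    (integrable_of_Icc hf hfb).integral_eq_integral_Ioc_meas_le
      (ae_of_all _ fun x => (hfb x).1) (ae_of_all _ fun x => (hfb x).2)
  rw [hlay μ inferInstance, hlay ν inferInstance,
    ← integral_sub (hint μ inferInstance) (hint ν inferInstance)]
  have h := norm_setIntegral_le_of_norm_le_const (μ := volume) (s := Set.Ioc 0 b)
    (f := fun t => μ.real {a | t ≤ f a} - ν.real {a | t ≤ f a}) (C := tvDist μ ν)
    measure_Ioc_lt_top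
    (fun t _ => abs_measureReal_sub_le_tvDist μ ν (measurableSet_le measurable_const hf))
  simpa [hb, mul_comm] using h

/-- The mean minimises the mean squared deviation; the gap is the squared distance of c from the
mean. This lets variances be compared by centring at a convenient point, such as the mean under
another measure or the midpoint of the range. -/
lemma popVar_le_integral_sub_sq {ν : Measure X} [IsProbabilityMeasure ν] {v : X → ℝ}
    (hv : Measurable v) {B : ℝ} (hB : ∀ x, |v x| ≤ B) (c : ℝ) :
    popVar ν v ≤ ∫ x, (v x - c) ^ 2 ∂ν := by
  have h1 : Integrable v ν := integrable_of_bounded hv hB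
  have h2 : Integrable (fun x => v x ^ 2) ν := integrable_of_bounded (hv.pow_const 2)
    (B := B ^ 2) fun x => by
      rw [abs_pow]; exact pow_le_pow_left₀ (abs_nonneg _) (hB x) 2
  have : ∀ x, (v x - c) ^ 2 = v x ^ 2 - 2 * c * v x + c ^ 2 := fun x => by ring
  simp_rw [this]
  have h3 : Integrable (fun x => v x ^ 2 - 2 * c * v x) ν := h2.sub (h1.const_mul _)
  rw [integral_add h3 (integrable_const _), integral_sub h2 (h1.const_mul _),
    integral_const_mul, popVar]
  simp only [integral_const, probReal_univ, smul_eq_mul, one_mul]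
  nlinarith [sq_nonneg (∫ x, v x ∂ν - c)]

/-- Variances of a function with values in `[0, b]` under two measures. -/
lemma popVar_le_add_tvDist (μ ν : Measure X) [IsProbabilityMeasure μ] [IsProbabilityMeasure ν]
    {v : X → ℝ} (hv : Measurable v) {b : ℝ} (hb : 0 ≤ b) (hvb : ∀ x, v x ∈ Set.Icc 0 b) :
    popVar μ v ≤ popVar ν v + b ^ 2 * tvDist μ ν := by
  have habs : ∀ x, |v x| ≤ b := fun x => abs_le.2 ⟨by linarith [(hvb x).1], (hvb x).2⟩
  have hc := integral_mem_Icc_of_mem_Icc (ν := ν) hv hvb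
  rw [popVar_eq_integral_sq (ν := ν) hv habs]
  have h := abs_integral_sub_le_tvDist μ ν (f := fun x => (v x - ∫ y, v y ∂ν) ^ 2)
    ((hv.sub_const _).pow_const 2) (b := b ^ 2) (by positivity) (fun x => ⟨sq_nonneg _, by
      apply sq_le_sq'
      · linarith [(hvb x).1, hc.2]
      · linarith [(hvb x).2, hc.1]⟩)
  linarith [popVar_le_integral_sub_sq (ν := μ) hv habs (∫ y, v y ∂ν), (abs_le.1 h).2]

/-- Popoviciu's inequality, by centring at the midpoint. It is applied to the gap between the
optimal value and the previous iterate, which is where the progress of earlier epochs reduces the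
variance. -/
lemma popVar_le_sq_div_four {ν : Measure X} [IsProbabilityMeasure ν] {v : X → ℝ}
    (hv : Measurable v) {R : ℝ} (hR : ∀ x, v x ∈ Set.Icc 0 R) : popVar ν v ≤ (R / 2) ^ 2 := by
  have habs : ∀ x, |v x| ≤ R := fun x => abs_le.2 ⟨by linarith [(hR x).1, (hR x).2], (hR x).2⟩
  refine (popVar_le_integral_sub_sq hv habs (R / 2)).trans ?_
  refine (integral_mem_Icc_of_mem_Icc (a := 0) (b := (R / 2) ^ 2) (by fun_prop)
    fun x => ⟨sq_nonneg _, ?_⟩).2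
  apply sq_le_sq'
  · linarith [(hR x).1]
  · linarith [(hR x).2]

/-- Subadditivity of the standard deviation. -/
lemma sqrt_popVar_le_add {ν : Measure X} [IsProbabilityMeasure ν] {v w : X → ℝ}
    (hv : Measurable v) (hw : Measurable w) {B C : ℝ} (hB : ∀ x, |v x| ≤ B)
    (hC : ∀ x, |w x| ≤ C) :
    √(popVar ν v) ≤ √(popVar ν w) + √(popVar ν fun x => w x - v x) := by
  have hd : ∀ x, |w x - v x| ≤ C + B := fun x =>
    (abs_sub _ _).trans (add_le_add (hC x) (hB x))
  set p := popVar ν w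
  set q := popVar ν fun x => w x - v x
  have hp0 : 0 ≤ p := popVar_nonneg hw hC
  have hq0 : 0 ≤ q := popVar_nonneg (hw.sub hv) hd
  have hwi := integrable_of_bounded (ν := ν) hw hC
  have hvi := integrable_of_bounded (ν := ν) hv hB
  have hsw : ∀ x, |(w x - ∫ y, w y ∂ν)| ≤ C + |∫ y, w y ∂ν| := fun x =>
    (abs_sub _ _).trans (add_le_add (hC x) le_rfl)
  have hsd : ∀ x, |(w x - v x - ∫ y, (w y - v y) ∂ν)| ≤ C + B + |∫ y, (w y - v y) ∂ν| := fun x =>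
    (abs_sub _ _).trans (add_le_add (hd x) le_rfl)
  have hpi : Integrable (fun x => (w x - ∫ y, w y ∂ν) ^ 2) ν :=
    integrable_of_bounded (by fun_prop) (B := (C + |∫ y, w y ∂ν|) ^ 2) fun x => by
      rw [abs_pow]; exact pow_le_pow_left₀ (abs_nonneg _) (hsw x) 2
  have hqi : Integrable (fun x => (w x - v x - ∫ y, (w y - v y) ∂ν) ^ 2) ν :=
    integrable_of_bounded (by fun_prop) (B := (C + B + |∫ y, (w y - v y) ∂ν|) ^ 2) fun x => by
      rw [abs_pow]; exact pow_le_pow_left₀ (abs_nonneg _) (hsd x) 2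
  have hmean : ∫ y, (w y - v y) ∂ν = ∫ y, w y ∂ν - ∫ y, v y ∂ν := integral_sub hwi hvi
  -- a weighted Cauchy-Schwarz inequality with arbitrary weight
  have hweight : ∀ s : ℝ, 0 < s → popVar ν v ≤ (1 + s) * p + (1 + 1 / s) * q := by
    intro s hs
    rw [popVar_eq_integral_sq hv hB, show p = _ from popVar_eq_integral_sq hw hC,
      show q = _ from popVar_eq_integral_sq (hw.sub hv) hd, ← integral_const_mul, ← integral_const_mul,
      ← integral_add (hpi.const_mul _) (hqi.const_mul _)]
    have hvs : ∀ x, |(v x - ∫ y, v y ∂ν)| ≤ B + |∫ y, v y ∂ν| := fun x =>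
      (abs_sub _ _).trans (add_le_add (hB x) le_rfl)
    refine integral_mono (integrable_of_bounded (by fun_prop) (B := (B + |∫ y, v y ∂ν|) ^ 2)
      fun x => ?_) ((hpi.const_mul _).add (hqi.const_mul _)) fun x => ?_
    · rw [abs_pow]; exact pow_le_pow_left₀ (abs_nonneg _) (hvs x) 2
    · simp only [hmean]
      set a := w x - ∫ y, w y ∂ν with ha
      have e : v x - ∫ y, v y ∂ν = a - (w x - v x - (∫ y, w y ∂ν - ∫ y, v y ∂ν)) := by
        rw [ha]; ring
      rw [e]
      set c := w x - v x - (∫ y, w y ∂ν - ∫ y, v y ∂ν)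
      have h1 : 0 ≤ (s * a + c) ^ 2 / s := by positivity
      have h2 : (s * a + c) ^ 2 / s = s * a ^ 2 + 2 * a * c + 1 / s * c ^ 2 := by
        field_simp; ring
      nlinarith
  apply Real.sqrt_le_iff.2 ⟨by positivity, ?_⟩
  have hsp := Real.sq_sqrt hp0
  have hsq := Real.sq_sqrt hq0
  -- The best weight is √q/√p. Shifting both roots by κ avoids division by zero, and κ tends to 0 at
  -- the end.
  have hlim : ∀ κ : ℝ, 0 < κ → popVar ν v ≤ (√p + √q + κ + κ) ^ 2 := by
    intro κ hκ
    have hpp := Real.sqrt_nonneg p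
    have hqq := Real.sqrt_nonneg q
    have h := hweight ((√q + κ) / (√p + κ)) (by positivity)
    rw [one_div_div] at h
    refine h.trans ?_
    have h1 : (1 + (√q + κ) / (√p + κ)) * p ≤ (√p + √q + κ + κ) * (√p + κ) := by
      have : 1 + (√q + κ) / (√p + κ) = (√p + √q + κ + κ) / (√p + κ) := by field_simp; ring
      rw [this, div_mul_eq_mul_div, div_le_iff₀ (by positivity), mul_assoc]
      refine mul_le_mul_of_nonneg_left ?_ (by positivity)
      nlinarith
    have h2 : (1 + (√p + κ) / (√q + κ)) * q ≤ (√p + √q + κ + κ) * (√q + κ) := by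
      have : 1 + (√p + κ) / (√q + κ) = (√p + √q + κ + κ) / (√q + κ) := by field_simp; ring
      rw [this, div_mul_eq_mul_div, div_le_iff₀ (by positivity), mul_assoc]
      refine mul_le_mul_of_nonneg_left ?_ (by positivity)
      nlinarith
    nlinarith
  have hc : Filter.Tendsto (fun κ : ℝ => (√p + √q + κ + κ) ^ 2) (nhdsWithin 0 (Set.Ioi 0))
      (nhds ((√p + √q + 0 + 0) ^ 2)) :=
    (Continuous.tendsto (by fun_prop) 0).mono_left nhdsWithin_le_nhds
  have := ge_of_tendsto hc (Filter.eventually_of_mem self_mem_nhdsWithin fun κ hκ => hlim κ hκ)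
  simpa using this

end TotalVariation

/-! ### Bellman equations -/

namespace MDP

variable {X A : Type*} [MeasurableSpace X] [MeasurableSpace A] (M : MDP X A)

instance : IsMarkovKernel M.p := M.markov_p

instance (π : Policy X A) (t : ℕ) : IsMarkovKernel (π.rule t) := π.markov_rule t

/-- `r(x, a) + ∫ u ∂p(· | x, a)`. -/
noncomputable def lookahead (u : X → ℝ) (x : X) (a : A) : ℝ := M.r x a + ∫ y, u y ∂M.p (x, a)

instance isMarkovKernel_trajLaw (π : Policy X A) : ∀ j t, IsMarkovKernel (M.trajLaw π j t)
  | 0, _ => by rw [trajLaw]; infer_instance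
  | j + 1, t => by
      have := isMarkovKernel_trajLaw π j (t + 1)
      rw [trajLaw]
      refine Kernel.IsMarkovKernel.map _ ?_
      refine measurable_pi_lambda _ fun i => ?_
      refine Fin.cases ?_ (fun i => ?_) i
      · simpa using measurable_fst
      · simpa using! (measurable_pi_apply i).comp measurable_snd

/-- Expected total reward of `j` steps from time `t` on. -/
noncomputable def stepValue (π : Policy X A) (j t : ℕ) (x : X) : ℝ :=
  ∫ ω, ∑ i, M.r (ω i).1 (ω i).2 ∂(M.trajLaw π j t x)

lemma measurable_totalReward (j : ℕ) :
    Measurable fun ω : Fin j → X × A => ∑ i, M.r (ω i).1 (ω i).2 :=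
  Finset.measurable_fun_sum _ fun i _ => M.measurable_r.comp (measurable_pi_apply i)

lemma totalReward_mem_Icc {j : ℕ} (ω : Fin j → X × A) :
    ∑ i, M.r (ω i).1 (ω i).2 ∈ Set.Icc (0 : ℝ) j := by
  constructor
  · exact Finset.sum_nonneg fun i _ => (M.r_mem _ _).1
  · calc _ ≤ ∑ _i : Fin j, (1 : ℝ) := Finset.sum_le_sum fun i _ => (M.r_mem _ _).2
      _ = j := by simp

lemma measurable_stepValue (π : Policy X A) (j t : ℕ) : Measurable (M.stepValue π j t) :=
  ((M.measurable_totalReward j).stronglyMeasurable.integral_kernel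
    (κ := M.trajLaw π j t)).measurable

lemma stepValue_mem_Icc (π : Policy X A) (j t : ℕ) (x : X) :
    M.stepValue π j t x ∈ Set.Icc (0 : ℝ) j :=
  integral_mem_Icc_of_mem_Icc (M.measurable_totalReward j) M.totalReward_mem_Icc

lemma stepValue_zero (π : Policy X A) (t : ℕ) (x : X) : M.stepValue π 0 t x = 0 := by
  simp [stepValue]

/-- The trajectory law prepends the first state-action pair to a trajectory that is one step
shorter, so integrating out the tail first gives the Bellman equation of a policy. Counting the
steps to go makes this a structural recursion. -/
lemma stepValue_succ (π : Policy X A) (j t : ℕ) (x : X) :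
    M.stepValue π (j + 1) t x
      = ∫ a, M.lookahead (M.stepValue π j (t + 1)) x a ∂(π.rule t x) := by
  have hcons : Measurable fun q : (X × A) × (Fin j → X × A) =>
      (Fin.cons q.1 q.2 : Fin (j + 1) → X × A) := by
    refine measurable_pi_lambda _ fun i => ?_
    refine Fin.cases ?_ (fun i => ?_) i
    · simpa using measurable_fst
    · simpa using! (measurable_pi_apply i).comp measurable_snd
  have hm : Measurable fun q : (X × A) × (Fin j → X × A) =>
      M.r q.1.1 q.1.2 + ∑ i, M.r (q.2 i).1 (q.2 i).2 :=
    (M.measurable_r.comp measurable_fst).add ((M.measurable_totalReward j).comp measurable_snd)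
  rw [stepValue, trajLaw, Kernel.map_apply _ hcons,
    integral_map hcons.aemeasurable (M.measurable_totalReward _).aestronglyMeasurable]
  simp only [Fin.sum_univ_succ, Fin.cons_zero, Fin.cons_succ]
  rw [ProbabilityTheory.integral_compProd]
  swap
  · refine integrable_of_Icc hm (a := 0) (b := 1 + j) fun q => ⟨?_, ?_⟩
    · exact add_nonneg (M.r_mem _ _).1 (M.totalReward_mem_Icc q.2).1
    · exact add_le_add (M.r_mem _ _).2 (M.totalReward_mem_Icc q.2).2
  have hinner : ∀ z : X × A,
      ∫ y, (M.r z.1 z.2 + ∑ i, M.r (y i).1 (y i).2)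
        ∂(Kernel.prodMkLeft X (M.trajLaw π j (t + 1) ∘ₖ M.p)) (x, z)
        = M.lookahead (M.stepValue π j (t + 1)) z.1 z.2 := by
    intro z
    rw [Kernel.prodMkLeft_apply, integral_add (integrable_const _)
      (integrable_of_Icc (M.measurable_totalReward j) M.totalReward_mem_Icc),
      Kernel.integral_comp
        (integrable_of_Icc (M.measurable_totalReward j) M.totalReward_mem_Icc)]
    simp [lookahead, stepValue]
  simp_rw [hinner]
  rw [Kernel.prod_apply, Kernel.id_apply, Measure.dirac_prod,
    integral_map measurable_prodMk_left.aemeasurable]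
  refine (Measurable.add ?_ ?_).aestronglyMeasurable
  · exact M.measurable_r
  · exact (StronglyMeasurable.integral_kernel
      (M.measurable_stepValue π j (t + 1)).stronglyMeasurable (κ := M.p)).measurable

lemma value_eq_stepValue (π : Policy X A) (t : ℕ) (x : X) :
    M.value π t x = M.stepValue π (M.H + 1 - t) t x := rfl

lemma value_succ (π : Policy X A) {t : ℕ} (ht : t ≤ M.H) (x : X) :
    M.value π t x = ∫ a, M.lookahead (M.value π (t + 1)) x a ∂(π.rule t x) := by
  have e1 : M.H + 1 - t = (M.H - t) + 1 := by omega
  have e2 : M.value π (t + 1) = M.stepValue π (M.H - t) (t + 1) := by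
    funext y
    rw [value_eq_stepValue, show M.H + 1 - (t + 1) = M.H - t by omega]
  rw [value_eq_stepValue, e1, stepValue_succ, e2]

lemma value_of_lt (π : Policy X A) {t : ℕ} (ht : M.H < t) (x : X) : M.value π t x = 0 := by
  rw [value_eq_stepValue, show M.H + 1 - t = 0 by omega, stepValue_zero]

lemma measurable_value (π : Policy X A) (t : ℕ) : Measurable (M.value π t) :=
  M.measurable_stepValue π _ t

lemma value_mem_Icc (π : Policy X A) (t : ℕ) (x : X) :
    M.value π t x ∈ Set.Icc (0 : ℝ) ((M.H + 1 - t : ℕ) : ℝ) :=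
  M.stepValue_mem_Icc π _ t x

lemma value_le_optValue (π : Policy X A) (t : ℕ) (x : X) : M.value π t x ≤ M.optValue t x :=
  le_ciSup (f := fun π => M.value π t x)
    ⟨((M.H + 1 - t : ℕ) : ℝ), by rintro _ ⟨π, rfl⟩; exact (M.value_mem_Icc π t x).2⟩ π

lemma measurable_lookahead {u : X → ℝ} (hu : Measurable u) :
    Measurable (Function.uncurry (M.lookahead u)) :=
  M.measurable_r.add (StronglyMeasurable.integral_kernel hu.stronglyMeasurable
    (κ := M.p)).measurable

lemma value_det [MeasurableSingletonClass A] {d : ℕ → X → A} (hd : ∀ t, Measurable (d t)) {t : ℕ}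
    (ht : t ≤ M.H) (x : X) :
    M.value (Policy.det d hd) t x
      = M.lookahead (M.value (Policy.det d hd) (t + 1)) x (d t x) := by
  rw [value_succ _ _ ht, Policy.det, Kernel.deterministic_apply, integral_dirac]

lemma lookahead_mono {u v : X → ℝ} (hu : Measurable u) (hv : Measurable v) {B C : ℝ}
    (hB : ∀ x, |u x| ≤ B) (hC : ∀ x, |v x| ≤ C) (h : ∀ x, u x ≤ v x) (x : X) (a : A) :
    M.lookahead u x a ≤ M.lookahead v x a :=
  add_le_add le_rfl
    (integral_mono (integrable_of_bounded hu hB) (integrable_of_bounded hv hC) h)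

/-! ### Dynamic programming upper bound for the optimal value -/

section Bellman

/-- Solution of the Bellman optimality equation with `j` steps to go. -/
noncomputable def bellman : ℕ → X → ℝ
  | 0 => 0
  | j + 1 => fun x => ⨆ a, M.lookahead (bellman j) x a

/-- The Bellman solution at time `t`. -/
noncomputable def bellmanAt (t : ℕ) : X → ℝ := M.bellman (M.H + 1 - t)

lemma bellmanAt_of_lt {t : ℕ} (ht : M.H < t) (x : X) : M.bellmanAt t x = 0 := by
  rw [bellmanAt, show M.H + 1 - t = 0 by omega]; rfl

variable [Fintype A]

lemma measurable_bellman (j : ℕ) : Measurable (M.bellman j) := by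
  induction j with
  | zero => exact measurable_const
  | succ j ih =>
    exact Measurable.iSup fun a => (M.measurable_lookahead ih).comp measurable_prodMk_right

lemma lookahead_le_bellman_succ (j : ℕ) (x : X) (a : A) :
    M.lookahead (M.bellman j) x a ≤ M.bellman (j + 1) x :=
  le_ciSup (f := fun a => M.lookahead (M.bellman j) x a) (Set.finite_range _).bddAbove a

lemma exists_bellman_succ_eq [Nonempty A] (j : ℕ) (x : X) :
    ∃ a, M.bellman (j + 1) x = M.lookahead (M.bellman j) x a := by
  obtain ⟨a, ha⟩ := exists_eq_ciSup_of_finite (f := fun a => M.lookahead (M.bellman j) x a)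
  exact ⟨a, ha.symm⟩

lemma bellman_mem_Icc [Nonempty A] (j : ℕ) (x : X) : M.bellman j x ∈ Set.Icc (0 : ℝ) j := by
  induction j generalizing x with
  | zero => simp [bellman]
  | succ j ih =>
    obtain ⟨a, ha⟩ := M.exists_bellman_succ_eq j x
    have := integral_mem_Icc_of_mem_Icc (ν := M.p (x, a)) (M.measurable_bellman j) ih
    have hr := M.r_mem x a
    rw [ha, lookahead]
    push_cast
    exact ⟨add_nonneg hr.1 this.1, by linarith [hr.2, this.2]⟩

/-- The average over a randomised action is at most the maximum over actions, at every step. -/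
lemma stepValue_le_bellman [Nonempty A] [DiscreteMeasurableSpace A] (π : Policy X A) (j t : ℕ) (x : X) :
    M.stepValue π j t x ≤ M.bellman j x := by
  induction j generalizing t x with
  | zero => simp [stepValue_zero, bellman]
  | succ j ih =>
    rw [stepValue_succ]
    have hi : Integrable (M.lookahead (M.stepValue π j (t + 1)) x) (π.rule t x) :=
      Integrable.of_finite
    calc _ ≤ ∫ _a, M.bellman (j + 1) x ∂(π.rule t x) := by
          refine integral_mono hi (integrable_const _) fun a => ?_
          refine le_trans ?_ (M.lookahead_le_bellman_succ j x a)
          refine M.lookahead_mono (M.measurable_stepValue _ _ _) (M.measurable_bellman j)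
            (B := j) (C := j) (fun y => ?_) (fun y => ?_) (ih (t + 1)) x a
          · rw [abs_of_nonneg (M.stepValue_mem_Icc _ _ _ _).1]
            exact (M.stepValue_mem_Icc _ _ _ _).2
          · rw [abs_of_nonneg (M.bellman_mem_Icc _ _).1]
            exact (M.bellman_mem_Icc _ _).2
      _ = _ := by simp

lemma value_le_bellmanAt [Nonempty A] [DiscreteMeasurableSpace A] (π : Policy X A) (t : ℕ) (x : X) :
    M.value π t x ≤ M.bellmanAt t x :=
  M.stepValue_le_bellman π _ t x

/-- Only this direction is needed. Closeness of the iterates to the Bellman solution gives closeness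
to the optimal value, while the upper bounds refer to values of actual policies. No optimal policy
has to be constructed. -/
lemma optValue_le_bellmanAt [Nonempty A] [DiscreteMeasurableSpace A] (t : ℕ) (x : X) :
    M.optValue t x ≤ M.bellmanAt t x := by
  have : Nonempty (Policy X A) :=
    ⟨Policy.det (fun _ _ => Classical.arbitrary A) fun _ => measurable_const⟩
  exact ciSup_le fun π => M.value_le_bellmanAt π t x

lemma measurable_bellmanAt (t : ℕ) : Measurable (M.bellmanAt t) := M.measurable_bellman _

lemma exists_bellmanAt_eq [Nonempty A] {t : ℕ} (ht : t ≤ M.H) (x : X) :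
    ∃ a, M.bellmanAt t x = M.lookahead (M.bellmanAt (t + 1)) x a := by
  have := M.exists_bellman_succ_eq (M.H - t) x
  rwa [bellmanAt, bellmanAt, show M.H + 1 - t = M.H - t + 1 by omega,
    show M.H + 1 - (t + 1) = M.H - t by omega]

lemma bellmanAt_mem_Icc [Nonempty A] (t : ℕ) (x : X) :
    M.bellmanAt t x ∈ Set.Icc (0 : ℝ) ((M.H + 1 - t : ℕ) : ℝ) := M.bellman_mem_Icc _ x

end Bellman

end MDP

/-! ### Structure of the iteration -/

namespace SolverInput

/-- The quantizer takes finitely many values, so measurability for each fixed cell gives joint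
measurability. -/
lemma measurable_cell {X A : Type*} (I : SolverInput X A) [MeasurableSpace X] {Ω : Type*}
    [MeasurableSpace Ω] [MeasurableSingletonClass X] (hQ : Measurable I.Q) {E : Type*}
    [MeasurableSpace E] {G : Ω → I.S → E} (hG : ∀ s, Measurable fun ω => G ω s) :
    Measurable fun p : Ω × X => G p.1 (I.Q p.2) := by
  have : Measurable fun p : Ω × I.S => G p.1 p.2 := measurable_from_prod_countable_left hG
  exact this.comp (measurable_fst.prodMk (hQ.comp measurable_snd))

variable {X A : Type*} [Fintype A] (I : SolverInput X A) (H : ℕ) (r : X → A → ℝ)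

/-! ### Monotonicity and locality of one epoch -/

section Epoch

variable (k : ℕ) (v : ℕ → X → ℝ) (d : ℕ → X → A) (xs : I.Batch H k) (ys : I.FreshBatch H)

/-- The score of an action in the cell of `x` at time `t`. -/
noncomputable def cellScore {t : ℕ} (ht : t ∈ Finset.Icc 1 H) (x : X) : A → ℝ :=
  I.score H r k (I.epochValue H r k v xs ys (t + 1)) (v (t + 1)) (I.Q x) (xs (I.Q x))
    (ys ⟨t, ht⟩ (I.Q x))

lemma epochValue_of_notMem {t : ℕ} (ht : t ∉ Finset.Icc 1 H) :
    I.epochValue H r k v xs ys t = 0 := by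
  rw [epochValue, dif_neg ht]

lemma epochValue_of_mem {t : ℕ} (ht : t ∈ Finset.Icc 1 H) (x : X) :
    I.epochValue H r k v xs ys t x =
      if (⨆ a, I.cellScore H r k v xs ys ht x a) - I.disc ≤ v t (I.Q x) then v t x
      else (⨆ a, I.cellScore H r k v xs ys ht x a) - I.disc := by
  rw [epochValue, dif_pos ht]; rfl

lemma epochPolicy_of_mem {t : ℕ} (ht : t ∈ Finset.Icc 1 H) (x : X) :
    I.epochPolicy H r k v d xs ys t x =
      if (⨆ a, I.cellScore H r k v xs ys ht x a) - I.disc ≤ v t (I.Q x) then d t x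
      else I.argmax (I.cellScore H r k v xs ys ht x) := by
  rw [epochPolicy, dif_pos ht]; rfl

lemma epochPolicy_of_notMem {t : ℕ} (ht : t ∉ Finset.Icc 1 H) :
    I.epochPolicy H r k v d xs ys t = d t := by
  rw [epochPolicy, dif_neg ht]

variable {v}

/-- The update looks at x only through its cell. Hence iterates stay constant on cells, which makes
the comparison at the cell centre valid on the whole cell and reduces bounds on the iterates to
finitely many values. -/
lemma epochValue_factor (hQ : ∀ x, I.Q (I.Q x) = I.Q x) (hv : ∀ t x, v t x = v t (I.Q x))
    (t : ℕ) (x : X) :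
    I.epochValue H r k v xs ys t x = I.epochValue H r k v xs ys t (I.Q x) := by
  by_cases ht : t ∈ Finset.Icc 1 H
  · have e : I.cellScore H r k v xs ys ht (I.Q x) = I.cellScore H r k v xs ys ht x := by
      rw [cellScore, cellScore, hQ]
    rw [epochValue_of_mem _ _ _ _ _ _ _ ht, epochValue_of_mem _ _ _ _ _ _ _ ht, e, hQ, hv t x]
  · rw [epochValue_of_notMem _ _ _ _ _ _ _ ht]; rfl

lemma le_epochValue (hv : ∀ t x, v t x = v t (I.Q x)) {t : ℕ} (ht : t ∈ Finset.Icc 1 H) (x : X) :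
    v t x ≤ I.epochValue H r k v xs ys t x := by
  rw [epochValue_of_mem _ _ _ _ _ _ _ ht]
  split_ifs with h
  · exact le_rfl
  · rw [hv]; exact (not_le.1 h).le

/-- Both branches return at least the candidate c, which dominates the lowered score of every
action. This drives the lower bound on the iterates and can be used with an action the algorithm did
not choose. -/
lemma cellScore_sub_disc_le_epochValue (hv : ∀ t x, v t x = v t (I.Q x)) {t : ℕ}
    (ht : t ∈ Finset.Icc 1 H) (x : X) (a : A) :
    I.cellScore H r k v xs ys ht x a - I.disc ≤ I.epochValue H r k v xs ys t x := by
  have h1 : I.cellScore H r k v xs ys ht x a ≤ ⨆ a, I.cellScore H r k v xs ys ht x a :=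
    le_ciSup (Set.finite_range _).bddAbove a
  rw [epochValue_of_mem _ _ _ _ _ _ _ ht]
  split_ifs with h
  · rw [hv]; linarith
  · linarith

/-- Either a cell keeps its value and action, or its value is the lowered score of its action. -/
lemma epoch_step_cases (hmax : ∀ (f : A → ℝ) (a : A), f a ≤ f (I.argmax f)) [Nonempty A] {t : ℕ}
    (ht : t ∈ Finset.Icc 1 H) (x : X) :
    (I.epochValue H r k v xs ys t x = v t x ∧ I.epochPolicy H r k v d xs ys t x = d t x) ∨
      I.epochValue H r k v xs ys t x
        = I.cellScore H r k v xs ys ht x (I.epochPolicy H r k v d xs ys t x) - I.disc := by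
  rw [epochValue_of_mem _ _ _ _ _ _ _ ht, epochPolicy_of_mem _ _ _ _ _ _ _ _ ht]
  split_ifs with h
  · exact Or.inl ⟨rfl, rfl⟩
  · right
    congr 1
    exact le_antisymm (ciSup_le (hmax _)) (le_ciSup (Set.finite_range _).bddAbove _)

/-- The recursion at time t reads fresh batches of times t and later only. Consequently the
increment at t + 1 is independent of the batch used to average it at time t. -/
lemma epochValue_congr {ys' : I.FreshBatch H} {t : ℕ}
    (h : ∀ t' : Finset.Icc 1 H, t ≤ t' → ys t' = ys' t') :
    I.epochValue H r k v xs ys t = I.epochValue H r k v xs ys' t := by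
  by_cases ht : t ∈ Finset.Icc 1 H
  · have ih := epochValue_congr (t := t + 1) (fun t' h' => h t' (by omega))
    funext x
    rw [epochValue_of_mem _ _ _ _ _ _ _ ht, epochValue_of_mem _ _ _ _ _ _ _ ht]
    have e : I.cellScore H r k v xs ys ht x = I.cellScore H r k v xs ys' ht x := by
      rw [cellScore, cellScore, ih, h ⟨t, ht⟩ le_rfl]
    rw [e]
  · rw [epochValue_of_notMem _ _ _ _ _ _ _ ht, epochValue_of_notMem _ _ _ _ _ _ _ ht]
termination_by H + 1 - t
decreasing_by
  have := Finset.mem_Icc.mp ht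
  omega

end Epoch

/-! ### Joint measurability in the answers and the state -/

section Measurability

variable [MeasurableSpace X] {Ω : Type*} [MeasurableSpace Ω]

lemma measurable_empMean {m : ℕ} {w : Ω → X → ℝ} (hw : Measurable (Function.uncurry w))
    {xs : Ω → Fin m → X} (hxs : ∀ i, Measurable fun ω => xs ω i) :
    Measurable fun ω => empMean (w ω) (xs ω) := by
  unfold empMean
  refine Measurable.div_const (Finset.measurable_fun_sum _ fun i _ => ?_) _
  exact hw.comp (measurable_id.prodMk (hxs i))

lemma measurable_muHat (k : ℕ) {w : Ω → X → ℝ} (hw : Measurable (Function.uncurry w))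
    {xs : Ω → Fin (I.m H k) → X} (hxs : ∀ i, Measurable fun ω => xs ω i) :
    Measurable fun ω => I.muHat H k (w ω) (xs ω) := by
  have h1 := measurable_empMean hw hxs
  have h2 := measurable_empMean (w := fun ω x => w ω x ^ 2) (hw.pow_const 2) hxs
  unfold muHat empVar
  exact (h1.sub ((h2.sub (h1.pow_const 2)).const_mul _).sqrt).sub_const _

lemma measurable_betaHat (k : ℕ) {w v : Ω → X → ℝ} (hw : Measurable (Function.uncurry w))
    (hv : Measurable (Function.uncurry v))
    {ys : Ω → Fin (I.l H) → X} (hys : ∀ i, Measurable fun ω => ys ω i) :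
    Measurable fun ω => I.betaHat H k (w ω) (v ω) (ys ω) := by
  unfold betaHat
  exact ((measurable_empMean (w := fun ω x => w ω x - v ω x) (hw.sub hv) hys).sub_const
    _).sub_const _

lemma measurable_score (k : ℕ) {w v : Ω → X → ℝ} (hw : Measurable (Function.uncurry w))
    (hv : Measurable (Function.uncurry v)) {xs : Ω → I.Batch H k}
    (hxs : ∀ s a i, Measurable fun ω => xs ω s a i) {ys : Ω → I.S → A → Fin (I.l H) → X}
    (hys : ∀ s a i, Measurable fun ω => ys ω s a i) (s : I.S) (a : A) :
    Measurable fun ω => I.score H r k (w ω) (v ω) s (xs ω s) (ys ω s) a := by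
  unfold score
  exact ((I.measurable_muHat H k hv (hxs s a)).const_add _).add
    (I.measurable_betaHat H k hw hv (hys s a))

lemma measurable_epochValue [MeasurableSingletonClass X] (hQ : Measurable I.Q) (k : ℕ)
    {v : Ω → ℕ → X → ℝ} (hv : ∀ t, Measurable (Function.uncurry fun ω => v ω t))
    {xs : Ω → I.Batch H k} (hxs : ∀ s a i, Measurable fun ω => xs ω s a i)
    {ys : Ω → I.FreshBatch H} (hys : ∀ t s a i, Measurable fun ω => ys ω t s a i) (t : ℕ) :
    Measurable (Function.uncurry fun ω => I.epochValue H r k (v ω) (xs ω) (ys ω) t) := by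
  by_cases ht : t ∈ Finset.Icc 1 H
  · have ih := measurable_epochValue hQ k hv hxs hys (t + 1)
    have hc : Measurable fun p : Ω × X =>
        (⨆ a, I.cellScore H r k (v p.1) (xs p.1) (ys p.1) ht p.2 a) - I.disc := by
      refine Measurable.sub_const (Measurable.iSup fun a => ?_) _
      exact I.measurable_cell hQ (G := fun ω s => I.score H r k
        (I.epochValue H r k (v ω) (xs ω) (ys ω) (t + 1)) (v ω (t + 1)) s (xs ω s)
        (ys ω ⟨t, ht⟩ s) a)
        fun s => I.measurable_score H r k ih (hv (t + 1)) hxs (hys ⟨t, ht⟩) s a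
    have hvs : Measurable fun p : Ω × X => v p.1 t (I.Q p.2) :=
      I.measurable_cell hQ (G := fun ω s => v ω t s) fun s =>
        (hv t).comp (measurable_id.prodMk measurable_const)
    have e : (Function.uncurry fun ω => I.epochValue H r k (v ω) (xs ω) (ys ω) t) =
        fun p : Ω × X =>
          if (⨆ a, I.cellScore H r k (v p.1) (xs p.1) (ys p.1) ht p.2 a) - I.disc
            ≤ v p.1 t (I.Q p.2) then v p.1 t p.2
          else (⨆ a, I.cellScore H r k (v p.1) (xs p.1) (ys p.1) ht p.2 a) - I.disc := by
      funext p
      exact I.epochValue_of_mem H r k (v p.1) (xs p.1) (ys p.1) ht p.2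
    rw [e]
    exact Measurable.ite (measurableSet_le hc hvs) (hv t) hc
  · simp_rw [epochValue_of_notMem _ _ _ _ _ _ _ ht]
    exact measurable_const
termination_by H + 1 - t
decreasing_by
  have := Finset.mem_Icc.mp ht
  omega

lemma measurable_epochPolicy [MeasurableSingletonClass X] [MeasurableSpace A]
    (hQ : Measurable I.Q) (k : ℕ) {v : ℕ → X → ℝ}
    {d : ℕ → X → A} (hd : ∀ t, Measurable (d t)) (xs : I.Batch H k) (ys : I.FreshBatch H) (t : ℕ) :
    Measurable (I.epochPolicy H r k v d xs ys t) := by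
  by_cases ht : t ∈ Finset.Icc 1 H
  · have e : I.epochPolicy H r k v d xs ys t = _ :=
      funext fun x => I.epochPolicy_of_mem H r k v d xs ys ht x
    rw [e]
    have hcell : ∀ {E : Type _} [MeasurableSpace E] (G : I.S → E),
        Measurable fun x => G (I.Q x) := fun G => (measurable_of_countable G).comp hQ
    refine Measurable.ite ?_ (hd t) ?_
    · exact hQ (Set.toFinite {s : I.S | (⨆ a, I.score H r k (I.epochValue H r k v xs ys (t + 1))
        (v (t + 1)) s (xs s) (ys ⟨t, ht⟩ s) a) - I.disc ≤ v t s}).measurableSet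
    · exact hcell fun s => I.argmax (I.score H r k (I.epochValue H r k v xs ys (t + 1))
        (v (t + 1)) s (xs s) (ys ⟨t, ht⟩ s))
  · rw [epochPolicy_of_notMem _ _ _ _ _ _ _ _ ht]
    exact hd t

end Measurability

/-! ### The iterates as functions of the oracle answers -/

section Run

/-- The batches of epoch `k` among all answers. -/
def batch (ω : I.Call H → X) {k : ℕ} (hk : k ∈ Finset.Icc 1 (I.K H)) : I.Batch H k :=
  fun s a i => ω (Sum.inl ⟨⟨k, hk⟩, s, a, i⟩)

/-- The fresh batches of epoch `k` among all answers. -/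
def freshBatch (ω : I.Call H → X) {k : ℕ} (hk : k ∈ Finset.Icc 1 (I.K H)) : I.FreshBatch H :=
  fun t s a i => ω (Sum.inr (⟨k, hk⟩, t, s, a, i))

lemma run_succ_of_mem (ω : I.Call H → X) {k : ℕ} (hk : k + 1 ∈ Finset.Icc 1 (I.K H)) :
    I.run H r ω (k + 1) =
      (I.epochValue H r (k + 1) (I.u H r ω k) (I.batch H ω hk) (I.freshBatch H ω hk),
        I.epochPolicy H r (k + 1) (I.u H r ω k) (I.pol H r ω k) (I.batch H ω hk)
          (I.freshBatch H ω hk)) := by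
  rw [run, dif_pos hk]; rfl

lemma run_succ_of_notMem (ω : I.Call H → X) {k : ℕ} (hk : k + 1 ∉ Finset.Icc 1 (I.K H)) :
    I.run H r ω (k + 1) = I.run H r ω k := by
  rw [run, dif_neg hk]

lemma u_succ (ω : I.Call H → X) {k : ℕ} (hk : k + 1 ∈ Finset.Icc 1 (I.K H)) :
    I.u H r ω (k + 1) =
      I.epochValue H r (k + 1) (I.u H r ω k) (I.batch H ω hk) (I.freshBatch H ω hk) := by
  funext t x; rw [u, run_succ_of_mem _ _ _ _ hk]

lemma pol_succ (ω : I.Call H → X) {k : ℕ} (hk : k + 1 ∈ Finset.Icc 1 (I.K H)) :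
    I.pol H r ω (k + 1) =
      I.epochPolicy H r (k + 1) (I.u H r ω k) (I.pol H r ω k) (I.batch H ω hk)
        (I.freshBatch H ω hk) := by
  funext t x; rw [pol, run_succ_of_mem _ _ _ _ hk]

lemma u_succ_of_notMem (ω : I.Call H → X) {k : ℕ} (hk : k + 1 ∉ Finset.Icc 1 (I.K H)) :
    I.u H r ω (k + 1) = I.u H r ω k := by
  funext t x; rw [u, run_succ_of_notMem _ _ _ _ hk]; rfl

lemma pol_succ_of_notMem (ω : I.Call H → X) {k : ℕ} (hk : k + 1 ∉ Finset.Icc 1 (I.K H)) :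
    I.pol H r ω (k + 1) = I.pol H r ω k := by
  funext t x; rw [pol, run_succ_of_notMem _ _ _ _ hk]; rfl

lemma u_zero (ω : I.Call H → X) : I.u H r ω 0 = 0 := rfl

lemma u_of_notMem (ω : I.Call H → X) (k : ℕ) {t : ℕ} (ht : t ∉ Finset.Icc 1 H) :
    I.u H r ω k t = 0 := by
  induction k with
  | zero => rfl
  | succ k ih =>
    by_cases hk : k + 1 ∈ Finset.Icc 1 (I.K H)
    · rw [u_succ _ _ _ _ hk, epochValue_of_notMem _ _ _ _ _ _ _ ht]
    · rw [u_succ_of_notMem _ _ _ _ hk, ih]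

lemma u_factor (hQ : ∀ x, I.Q (I.Q x) = I.Q x) (ω : I.Call H → X) (k t : ℕ) (x : X) :
    I.u H r ω k t x = I.u H r ω k t (I.Q x) := by
  induction k generalizing t x with
  | zero => rfl
  | succ k ih =>
    by_cases hk : k + 1 ∈ Finset.Icc 1 (I.K H)
    · rw [u_succ _ _ _ _ hk, epochValue_factor _ _ _ _ _ _ hQ ih]
    · rw [u_succ_of_notMem _ _ _ _ hk, ih]

lemma u_le_u_succ (hQ : ∀ x, I.Q (I.Q x) = I.Q x) (ω : I.Call H → X) (k t : ℕ) (x : X) :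
    I.u H r ω k t x ≤ I.u H r ω (k + 1) t x := by
  by_cases ht : t ∈ Finset.Icc 1 H
  · by_cases hk : k + 1 ∈ Finset.Icc 1 (I.K H)
    · rw [u_succ _ _ _ _ hk]
      exact I.le_epochValue H r _ _ _ (I.u_factor H r hQ ω k) ht x
    · rw [u_succ_of_notMem _ _ _ _ hk]
  · rw [u_of_notMem _ _ _ _ _ ht, u_of_notMem _ _ _ _ _ ht]

lemma u_nonneg (hQ : ∀ x, I.Q (I.Q x) = I.Q x) (ω : I.Call H → X) (k t : ℕ) (x : X) :
    0 ≤ I.u H r ω k t x := by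
  induction k with
  | zero => exact le_rfl
  | succ k ih => exact ih.trans (I.u_le_u_succ H r hQ ω k t x)

lemma exists_abs_u_le (hQ : ∀ x, I.Q (I.Q x) = I.Q x) (ω : I.Call H → X) (k t : ℕ) :
    ∃ B, ∀ x, |I.u H r ω k t x| ≤ B := by
  obtain ⟨B, hB⟩ := (Set.finite_range fun s : I.S => |I.u H r ω k t s|).bddAbove
  exact ⟨B, fun x => by rw [I.u_factor H r hQ]; exact hB ⟨I.Q x, rfl⟩⟩

/-- The first `k` epochs depend only on the answers to their calls. -/
lemma run_congr {ω ω' : I.Call H → X} {k : ℕ}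
    (h1 : ∀ (j : Finset.Icc 1 (I.K H)) s a i, (j : ℕ) ≤ k → ω (Sum.inl ⟨j, s, a, i⟩) = ω' (Sum.inl ⟨j, s, a, i⟩))
    (h2 : ∀ (j : Finset.Icc 1 (I.K H)) t s a i, (j : ℕ) ≤ k → ω (Sum.inr (j, t, s, a, i)) = ω' (Sum.inr (j, t, s, a, i))) :
    I.run H r ω k = I.run H r ω' k := by
  induction k with
  | zero => rfl
  | succ k ih =>
    have ih := ih (fun j s a i hj => h1 j s a i (by omega))
      (fun j t s a i hj => h2 j t s a i (by omega))
    by_cases hk : k + 1 ∈ Finset.Icc 1 (I.K H)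
    · have e1 : I.batch H ω hk = I.batch H ω' hk := by
        funext s a i; exact h1 _ _ _ _ le_rfl
      have e2 : I.freshBatch H ω hk = I.freshBatch H ω' hk := by
        funext t s a i; exact h2 _ _ _ _ _ le_rfl
      have e3 : I.u H r ω k = I.u H r ω' k := by funext t x; rw [u, ih]; rfl
      have e4 : I.pol H r ω k = I.pol H r ω' k := by funext t x; rw [pol, ih]; rfl
      rw [run_succ_of_mem _ _ _ _ hk, run_succ_of_mem _ _ _ _ hk, e1, e2, e3, e4]
    · rw [run_succ_of_notMem _ _ _ _ hk, run_succ_of_notMem _ _ _ _ hk, ih]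

lemma measurable_u [MeasurableSpace X] [MeasurableSingletonClass X] (hQm : Measurable I.Q)
    (k t : ℕ) :
    Measurable (Function.uncurry fun ω : I.Call H → X => I.u H r ω k t) := by
  induction k generalizing t with
  | zero => exact measurable_const
  | succ k ih =>
    by_cases hk : k + 1 ∈ Finset.Icc 1 (I.K H)
    · simp_rw [u_succ _ _ _ _ hk]
      exact I.measurable_epochValue H r hQm (k + 1) ih
        (fun s a i => measurable_pi_apply _) (fun t s a i => measurable_pi_apply _) t
    · simp_rw [u_succ_of_notMem _ _ _ _ hk]
      exact ih t

lemma measurable_pol [MeasurableSpace X] [MeasurableSingletonClass X] [MeasurableSpace A]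
    (hQm : Measurable I.Q) (hπ : ∀ t, Measurable (I.π₀ t)) (ω : I.Call H → X) (k t : ℕ) :
    Measurable (I.pol H r ω k t) := by
  induction k generalizing t with
  | zero => exact hπ t
  | succ k ih =>
    by_cases hk : k + 1 ∈ Finset.Icc 1 (I.K H)
    · rw [pol_succ _ _ _ _ hk]
      exact I.measurable_epochPolicy H r hQm (k + 1) ih _ _ t
    · rw [pol_succ_of_notMem _ _ _ _ hk]
      exact ih t

end Run

end SolverInput

/-! ### Resampling a block of coordinates -/

section Resampling

variable {ι X : Type*} [MeasurableSpace X] {m : ℕ}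

lemma measurable_extend (e : Fin m → ι) :
    Measurable fun p : (ι → X) × (Fin m → X) => Function.extend e p.2 p.1 := by
  classical
  refine measurable_pi_lambda _ fun i => ?_
  by_cases hi : ∃ j, e j = i
  · have : (fun p : (ι → X) × (Fin m → X) => Function.extend e p.2 p.1 i)
        = fun p => p.2 hi.choose := by
      funext p
      simp [Function.extend_def, hi]
    rw [this]
    exact (measurable_pi_apply _).comp measurable_snd
  · simp_rw [Function.extend_apply' _ _ _ hi]
    exact (measurable_pi_apply _).comp measurable_fst

variable [Fintype ι]

/-- Overwriting a block of coordinates by an independent copy preserves a product measure. -/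
lemma map_extend_pi (μ : ι → Measure X) [∀ i, IsProbabilityMeasure (μ i)] {e : Fin m → ι}
    (he : Function.Injective e) {ν : Measure X} [IsProbabilityMeasure ν] (hν : ∀ j, μ (e j) = ν) :
    ((Measure.pi μ).prod (Measure.pi fun _ : Fin m => ν)).map
      (fun p => Function.extend e p.2 p.1) = Measure.pi μ := by
  classical
  symm
  refine Measure.pi_eq fun s hs => ?_
  rw [Measure.map_apply (measurable_extend e) (MeasurableSet.univ_pi hs)]
  have hpre : (fun p : (ι → X) × (Fin m → X) => Function.extend e p.2 p.1) ⁻¹' Set.univ.pi s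
      = (Set.univ.pi fun i => if i ∈ Finset.univ.image e then Set.univ else s i) ×ˢ
        (Set.univ.pi fun j => s (e j)) := by
    ext p
    simp only [Set.mem_preimage, Set.mem_pi, Set.mem_univ, true_imp_iff, Set.mem_prod]
    constructor
    · intro h
      refine ⟨fun i => ?_, fun j => ?_⟩
      · split_ifs with hi
        · trivial
        · have := h i
          rwa [Function.extend_apply' _ _ _ (by simpa using hi)] at this
      · simpa only [he.extend_apply] using h (e j)
    · rintro ⟨h1, h2⟩ i
      by_cases hi : ∃ j, e j = i
      · obtain ⟨j, rfl⟩ := hi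
        rw [he.extend_apply]; exact h2 j
      · have := h1 i
        rw [if_neg (by simpa using hi)] at this
        rwa [Function.extend_apply' _ _ _ hi]
  rw [hpre, Measure.prod_prod, Measure.pi_pi, Measure.pi_pi,
    ← Finset.prod_mul_prod_compl (Finset.univ.image e) fun i => μ i (s i),
    Finset.prod_image he.injOn,
    ← Finset.prod_mul_prod_compl (Finset.univ.image e)
      fun i => μ i (if i ∈ Finset.univ.image e then Set.univ else s i)]
  have h1 : ∏ i ∈ Finset.univ.image e,
      μ i (if i ∈ Finset.univ.image e then Set.univ else s i) = 1 :=
    Finset.prod_eq_one fun i hi => by rw [if_pos hi, measure_univ]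
  have h2 : ∏ i ∈ (Finset.univ.image e)ᶜ,
      μ i (if i ∈ Finset.univ.image e then Set.univ else s i)
      = ∏ i ∈ (Finset.univ.image e)ᶜ, μ i (s i) :=
    Finset.prod_congr rfl fun i hi => by rw [if_neg (Finset.mem_compl.1 hi)]
  rw [h1, h2, one_mul, mul_comm]
  simp_rw [hν]

/-- By Fubini, a bound on the resampled block that is uniform in the remaining coordinates is a
bound on the event. This plays the role of conditioning on everything except one batch. -/
lemma pi_le_of_resample (μ : ι → Measure X) [∀ i, IsProbabilityMeasure (μ i)] {e : Fin m → ι}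
    (he : Function.Injective e) {ν : Measure X} [IsProbabilityMeasure ν] (hν : ∀ j, μ (e j) = ν)
    {B : Set (ι → X)} (hB : MeasurableSet B) {c : ℝ}
    (h : ∀ ω, (Measure.pi fun _ : Fin m => ν).real {xs | Function.extend e xs ω ∈ B} ≤ c) :
    Measure.pi μ B ≤ ENNReal.ofReal c := by
  rw [← map_extend_pi μ he hν, Measure.map_apply (measurable_extend e) hB,
    Measure.prod_apply (measurable_extend e hB)]
  calc _ ≤ ∫⁻ _ω : ι → X, ENNReal.ofReal c ∂(Measure.pi μ) := by
        refine lintegral_mono fun ω => ?_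
        rw [ENNReal.le_ofReal_iff_toReal_le (measure_ne_top _ _) (measureReal_nonneg.trans (h ω))]
        exact h ω
    _ = _ := by simp

end Resampling

/-! ### The good event -/

lemma measurable_integral_of_uncurry {X Ω : Type*} [MeasurableSpace X] [MeasurableSpace Ω] {w : Ω → X → ℝ}
    (hw : Measurable (Function.uncurry w)) (ν : Measure X) [IsProbabilityMeasure ν] :
    Measurable fun ω => ∫ y, w ω y ∂ν :=
  (StronglyMeasurable.integral_prod_right (ν := ν) hw.stronglyMeasurable).measurable

namespace SolverInput

variable {X A : Type*} [MeasurableSpace X] [MeasurableSpace A] [Fintype A]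
  (M : MDP X A) (I : SolverInput X A)

/-- The lowered empirical means of epoch `k + 1` for time `t` are accurate. -/
def MeanAccurate (ω : I.Call M.H → X) {k : ℕ} (hk : k + 1 ∈ Finset.Icc 1 (I.K M.H)) (t : ℕ)
    (s : I.S) (a : A) : Prop :=
  (∀ s' : I.S, I.u M.H M.r ω k (t + 1) s' ∈ Set.Icc (0 : ℝ) M.H) →
    I.muHat M.H (k + 1) (I.u M.H M.r ω k (t + 1)) (I.batch M.H ω hk s a)
        ≤ ∫ y, I.u M.H M.r ω k (t + 1) y ∂M.p (s, a) - I.disc * M.H ∧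
      ∫ y, I.u M.H M.r ω k (t + 1) y ∂M.p (s, a)
          - 2 * √(2 * I.θ M.H (k + 1) * popVar (M.p (s, a)) (I.u M.H M.r ω k (t + 1)))
          - (4 / 3 * I.θ M.H (k + 1) + 4 * (2 * I.θ M.H (k + 1)) ^ (3 / 4 : ℝ)) * M.H
          - I.disc * M.H
        ≤ I.muHat M.H (k + 1) (I.u M.H M.r ω k (t + 1)) (I.batch M.H ω hk s a)

/-- The range allowed for the increments of epoch `k + 1`. -/
noncomputable def incrRange (H k : ℕ) : ℝ := 2 * eps H (k + 1) + 12 * I.disc * H ^ 2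

/-- The empirical means of the increments of epoch `k + 1` for time `t` are accurate. -/
def IncrAccurate (ω : I.Call M.H → X) {k : ℕ} (hk : k + 1 ∈ Finset.Icc 1 (I.K M.H)) {t : ℕ}
    (ht : t ∈ Finset.Icc 1 M.H) (s : I.S) (a : A) : Prop :=
  (∀ s' : I.S, I.u M.H M.r ω (k + 1) (t + 1) s' - I.u M.H M.r ω k (t + 1) s'
      ∈ Set.Icc 0 (I.incrRange M.H k)) →
    |empMean (fun x => I.u M.H M.r ω (k + 1) (t + 1) x - I.u M.H M.r ω k (t + 1) x)
        (I.freshBatch M.H ω hk ⟨t, ht⟩ s a)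
      - ∫ x, (I.u M.H M.r ω (k + 1) (t + 1) x - I.u M.H M.r ω k (t + 1) x) ∂M.p (s, a)|
      ≤ I.incrRange M.H k / (32 * M.H)

variable [MeasurableSingletonClass X]

lemma measurableSet_not_meanAccurate (hQm : Measurable I.Q) {k : ℕ}
    (hk : k + 1 ∈ Finset.Icc 1 (I.K M.H)) (t : ℕ) (s : I.S) (a : A) :
    MeasurableSet {ω | ¬ I.MeanAccurate M ω hk t s a} := by
  have hu := I.measurable_u M.H M.r hQm k (t + 1)
  have h0 : ∀ x, Measurable fun ω : I.Call M.H → X => I.u M.H M.r ω k (t + 1) x := fun x =>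
    hu.comp (measurable_id.prodMk measurable_const)
  have h1 := measurable_integral_of_uncurry hu (M.p (s, a))
  have h2 : Measurable fun ω => popVar (M.p (s, a)) (I.u M.H M.r ω k (t + 1)) :=
    (measurable_integral_of_uncurry (w := fun ω x => I.u M.H M.r ω k (t + 1) x ^ 2)
      (hu.pow_const 2) (M.p (s, a))).sub (h1.pow_const 2)
  have h3 : Measurable fun ω =>
      I.muHat M.H (k + 1) (I.u M.H M.r ω k (t + 1)) (I.batch M.H ω hk s a) :=
    I.measurable_muHat M.H (k + 1) hu fun i => measurable_pi_apply _
  refine (MeasurableSet.imp ?_ ?_).compl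
  · rw [Set.ofPred_forall]
    exact MeasurableSet.iInter fun s' => (h0 s') measurableSet_Icc
  · exact (measurableSet_le h3 (h1.sub_const _)).inter
      (measurableSet_le (((h1.sub ((h2.const_mul _).sqrt.const_mul _)).sub_const _).sub_const _) h3)

lemma measurableSet_not_incrAccurate (hQm : Measurable I.Q) {k : ℕ}
    (hk : k + 1 ∈ Finset.Icc 1 (I.K M.H)) {t : ℕ} (ht : t ∈ Finset.Icc 1 M.H) (s : I.S) (a : A) :
    MeasurableSet {ω | ¬ I.IncrAccurate M ω hk ht s a} := by
  have hd : Measurable (Function.uncurry fun ω x =>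
      I.u M.H M.r ω (k + 1) (t + 1) x - I.u M.H M.r ω k (t + 1) x) :=
    (I.measurable_u M.H M.r hQm (k + 1) (t + 1)).sub (I.measurable_u M.H M.r hQm k (t + 1))
  have h0 : ∀ x, Measurable fun ω : I.Call M.H → X =>
      I.u M.H M.r ω (k + 1) (t + 1) x - I.u M.H M.r ω k (t + 1) x := fun x =>
    hd.comp (measurable_id.prodMk measurable_const)
  have h1 := measurable_integral_of_uncurry hd (M.p (s, a))
  have h2 := measurable_empMean hd (xs := fun ω => I.freshBatch M.H ω hk ⟨t, ht⟩ s a)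
    fun i => measurable_pi_apply _
  refine (MeasurableSet.imp ?_ ?_).compl
  · rw [Set.ofPred_forall]
    exact MeasurableSet.iInter fun s' => (h0 s') measurableSet_Icc
  · exact measurableSet_le (h2.sub h1).abs measurable_const

lemma answerLaw_not_meanAccurate_le (hQm : Measurable I.Q) (hQ : ∀ x, I.Q (I.Q x) = I.Q x)
    {k : ℕ} (hk : k + 1 ∈ Finset.Icc 1 (I.K M.H)) (hm : 0 < I.m M.H (k + 1))
    (hθ : 0 < I.θ M.H (k + 1)) (t : ℕ) (s : I.S) (a : A) :
    I.answerLaw M.H M.p {ω | ¬ I.MeanAccurate M ω hk t s a}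
      ≤ ENNReal.ofReal (6 * Real.exp (-I.logTerm M.H)) := by
  have hinj : Function.Injective
      fun i : Fin (I.m M.H (k + 1)) => (Sum.inl ⟨⟨k + 1, hk⟩, s, a, i⟩ : I.Call M.H) := by
    intro i j h
    simpa using h
  refine pi_le_of_resample _ hinj (ν := M.p (s, a)) (fun j => rfl)
    (I.measurableSet_not_meanAccurate M hQm hk t s a) fun ω => ?_
  set e := fun i : Fin (I.m M.H (k + 1)) => (Sum.inl ⟨⟨k + 1, hk⟩, s, a, i⟩ : I.Call M.H) with he
  -- The iterate of epoch k reads no answer of epoch k + 1, so it is a fixed function under the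
  -- resampling.
  have hu : ∀ xs, I.u M.H M.r (Function.extend e xs ω) k = I.u M.H M.r ω k := by
    intro xs
    funext t x
    rw [u, I.run_congr M.H M.r (ω' := ω)]
    · rfl
    · intro j s' a' i hj
      refine Function.extend_apply' _ _ _ ?_
      rintro ⟨i', hi'⟩
      simp only [he, Sum.inl.injEq, Sigma.mk.injEq] at hi'
      have := congrArg Subtype.val hi'.1
      simp only at this
      omega
    · intro j t s' a' i hj
      refine Function.extend_apply' _ _ _ ?_
      rintro ⟨i', hi'⟩
      simp [he] at hi'
  have hb : ∀ xs, I.batch M.H (Function.extend e xs ω) hk s a = xs := fun xs =>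
    funext fun i => hinj.extend_apply xs ω i
  set v := I.u M.H M.r ω k (t + 1) with hv
  have hmθ : I.m M.H (k + 1) * I.θ M.H (k + 1) = I.logTerm M.H := by
    rw [θ, mul_div_cancel₀]
    exact_mod_cast hm.ne'
  -- If the premise on the range fails, the accuracy statement is vacuously true and no resampled
  -- batch is bad.
  by_cases hrange : ∀ s' : I.S, v s' ∈ Set.Icc (0 : ℝ) M.H
  · have hrange' : ∀ x, v x ∈ Set.Icc (0 : ℝ) M.H := fun x => by
      rw [hv, I.u_factor M.H M.r hQ]; exact hrange _
    have hvm : Measurable v :=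
      (I.measurable_u M.H M.r hQm k (t + 1)).comp (measurable_const.prodMk measurable_id)
    have hH : (0 : ℝ) < M.H := by exact_mod_cast M.one_le_H
    have := lowered_empMean_concentration (M.p (s, a)) hm hvm hH hrange' hθ
    rw [hmθ] at this
    refine le_trans (measureReal_mono ?_ (measure_ne_top _ _)) this
    intro xs hxs hcon
    apply hxs
    intro _
    rw [hu, hb, ← hv, muHat]
    constructor <;> linarith [hcon.1, hcon.2]
  · have : {xs | Function.extend e xs ω ∈ {ω | ¬ I.MeanAccurate M ω hk t s a}} = ∅ := by
      ext xs
      simp only [Set.mem_ofPred_eq, Set.mem_empty_iff_false, iff_false, not_not]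
      intro h
      rw [hu] at h
      exact absurd h hrange
    rw [this, measureReal_empty]
    positivity

lemma answerLaw_not_incrAccurate_le (hQm : Measurable I.Q) (hQ : ∀ x, I.Q (I.Q x) = I.Q x)
    {k : ℕ} (hk : k + 1 ∈ Finset.Icc 1 (I.K M.H)) {t : ℕ} (ht : t ∈ Finset.Icc 1 M.H)
    {lam : ℝ} (hl : 512 * (M.H : ℝ) ^ 2 * lam ≤ I.l M.H) (hl0 : 0 < I.l M.H)
    (hR : 0 < I.incrRange M.H k) (s : I.S) (a : A) :
    I.answerLaw M.H M.p {ω | ¬ I.IncrAccurate M ω hk ht s a}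
      ≤ ENNReal.ofReal (2 * Real.exp (-lam)) := by
  have hinj : Function.Injective fun i : Fin (I.l M.H) =>
      (Sum.inr (⟨k + 1, hk⟩, ⟨t, ht⟩, s, a, i) : I.Call M.H) := by
    intro i j h
    simpa using h
  refine pi_le_of_resample _ hinj (ν := M.p (s, a)) (fun j => rfl)
    (I.measurableSet_not_incrAccurate M hQm hk ht s a) fun ω => ?_
  set e := fun i : Fin (I.l M.H) =>
    (Sum.inr (⟨k + 1, hk⟩, ⟨t, ht⟩, s, a, i) : I.Call M.H) with he
  have hu : ∀ xs, I.u M.H M.r (Function.extend e xs ω) k = I.u M.H M.r ω k := by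
    intro xs
    funext t x
    rw [u, I.run_congr M.H M.r (ω' := ω)]
    · rfl
    · intro j s' a' i hj
      refine Function.extend_apply' _ _ _ ?_
      rintro ⟨i', hi'⟩
      simp [he] at hi'
    · intro j t s' a' i hj
      refine Function.extend_apply' _ _ _ ?_
      rintro ⟨i', hi'⟩
      simp only [he, Sum.inr.injEq, Prod.mk.injEq] at hi'
      have := congrArg Subtype.val hi'.1
      simp only at this
      omega
  -- The current epoch's iterate at t + 1 is also frozen: within the epoch it uses the initial
  -- batches and the fresh batches of times beyond t.
  have hu' : ∀ xs, I.u M.H M.r (Function.extend e xs ω) (k + 1) (t + 1)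
      = I.u M.H M.r ω (k + 1) (t + 1) := by
    intro xs
    have hbatch : I.batch M.H (Function.extend e xs ω) hk = I.batch M.H ω hk := by
      funext s' a' i
      refine Function.extend_apply' _ _ _ ?_
      rintro ⟨i', hi'⟩
      simp [he] at hi'
    rw [u_succ _ _ _ _ hk, u_succ _ _ _ _ hk, hu, hbatch]
    refine I.epochValue_congr M.H M.r _ _ _ fun t' ht' => ?_
    funext s' a' i
    refine Function.extend_apply' _ _ _ ?_
    rintro ⟨i', hi'⟩
    simp only [he, Sum.inr.injEq, Prod.mk.injEq] at hi'
    have := congrArg Subtype.val hi'.2.1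
    simp only at this
    omega
  have hb : ∀ xs, I.freshBatch M.H (Function.extend e xs ω) hk ⟨t, ht⟩ s a = xs := fun xs =>
    funext fun i => hinj.extend_apply xs ω i
  set w := fun x => I.u M.H M.r ω (k + 1) (t + 1) x - I.u M.H M.r ω k (t + 1) x with hw
  by_cases hrange : ∀ s' : I.S, w s' ∈ Set.Icc (0 : ℝ) (I.incrRange M.H k)
  · have hrange' : ∀ x, w x ∈ Set.Icc (0 : ℝ) (I.incrRange M.H k) := fun x => by
      have := hrange (I.Q x)
      simpa only [hw, ← I.u_factor M.H M.r hQ] using this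
    have hwm : Measurable w :=
      ((I.measurable_u M.H M.r hQm (k + 1) (t + 1)).comp
        (measurable_const.prodMk measurable_id)).sub
      ((I.measurable_u M.H M.r hQm k (t + 1)).comp (measurable_const.prodMk measurable_id))
    have hH : (0 : ℝ) < M.H := by exact_mod_cast M.one_le_H
    have := hoeffding_abs (M.p (s, a)) hl0 hwm hrange' (y := I.incrRange M.H k / (32 * M.H))
      (lam := lam) (by positivity) (by
        rw [sub_zero]
        -- Hoeffding with tolerance R/(32H) needs 32²/2 = 512 times H²·lam samples, which is the
        -- constant in `l`.
        have e1 : 2 * (I.l M.H : ℝ) * (I.incrRange M.H k / (32 * M.H)) ^ 2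
            = (I.l M.H / (512 * (M.H : ℝ) ^ 2)) * I.incrRange M.H k ^ 2 := by
          field_simp; ring
        rw [e1]
        refine mul_le_mul_of_nonneg_right ?_ (sq_nonneg _)
        rw [le_div_iff₀ (by positivity)]
        linarith) hR
    refine le_trans (measureReal_mono ?_ (measure_ne_top _ _)) this
    intro xs hxs
    by_contra hcon
    apply hxs
    intro _
    rw [hu, hu', hb]
    exact not_lt.1 hcon
  · have : {xs | Function.extend e xs ω ∈ {ω | ¬ I.IncrAccurate M ω hk ht s a}} = ∅ := by
      ext xs
      simp only [Set.mem_ofPred_eq, Set.mem_empty_iff_false, iff_false, not_not]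
      intro h
      rw [hu, hu'] at h
      exact absurd h hrange
    rw [this, measureReal_empty]
    positivity

/-- All estimates made by the algorithm are accurate. -/
def AllAccurate (ω : I.Call M.H → X) : Prop :=
  ∀ (k : ℕ) (hk : k + 1 ∈ Finset.Icc 1 (I.K M.H)) (t : ℕ) (ht : t ∈ Finset.Icc 1 M.H)
    (s : I.S) (a : A), I.MeanAccurate M ω hk t s a ∧ I.IncrAccurate M ω hk ht s a

end SolverInput

/-! ### Parameters -/

namespace SolverInput

variable {X A : Type*} [Fintype A] (I : SolverInput X A) {H : ℕ}

lemma one_le_card_mul [Nonempty A] (hS : I.S.Nonempty) (hH : 1 ≤ H) (hK : 1 ≤ I.K H) :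
    (1 : ℝ) ≤ H * I.S.card * Fintype.card A * I.K H := by
  have h1 := hS.card_pos
  have h2 := Fintype.card_pos (α := A)
  have : 1 ≤ H * I.S.card * Fintype.card A * I.K H :=
    Nat.one_le_iff_ne_zero.2 (by positivity)
  exact_mod_cast this

/-- The argument of the logarithm is at least 4, which exceeds e. Among other things this makes all
batches nonempty. -/
lemma one_le_log_div [Nonempty A] (hS : I.S.Nonempty) (hH : 1 ≤ H) (hK : 1 ≤ I.K H)
    (hδ : 0 < I.δ) (hδ1 : I.δ < 1) {c : ℝ} (hc : 4 ≤ c) :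
    1 ≤ Real.log (c * H * I.S.card * Fintype.card A * I.K H / I.δ) := by
  have h := I.one_le_card_mul hS hH hK
  rw [Real.le_log_iff_exp_le (by
    rw [show c * (H : ℝ) * I.S.card * Fintype.card A * I.K H
      = c * (H * I.S.card * Fintype.card A * I.K H) by ring]
    exact div_pos (by nlinarith) hδ), le_div_iff₀ hδ,
    show c * (H : ℝ) * I.S.card * Fintype.card A * I.K H
      = c * (H * I.S.card * Fintype.card A * I.K H) by ring]
  have := Real.exp_one_lt_d9
  have h3 := Real.exp_pos 1
  nlinarith

lemma exp_neg_log_div [Nonempty A] (hS : I.S.Nonempty) (hH : 1 ≤ H) (hK : 1 ≤ I.K H)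
    (hδ : 0 < I.δ) {c : ℝ} (hc : 0 < c) :
    Real.exp (-Real.log (c * H * I.S.card * Fintype.card A * I.K H / I.δ))
      = I.δ / (c * (H * I.S.card * Fintype.card A * I.K H)) := by
  have h := I.one_le_card_mul hS hH hK
  have e : c * (H : ℝ) * I.S.card * Fintype.card A * I.K H
      = c * (H * I.S.card * Fintype.card A * I.K H) := by ring
  rw [e, Real.exp_neg, Real.exp_log (div_pos (by nlinarith) hδ), inv_div]

lemma one_le_logTerm [Nonempty A] (hS : I.S.Nonempty) (hH : 1 ≤ H) (hK : 1 ≤ I.K H)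
    (hδ : 0 < I.δ) (hδ1 : I.δ < 1) : 1 ≤ I.logTerm H :=
  I.one_le_log_div hS hH hK hδ hδ1 (by norm_num)

lemma eps_pos (hH : 1 ≤ H) (k : ℕ) : 0 < eps H k := by
  have : (0 : ℝ) < H := by exact_mod_cast hH
  unfold eps; positivity

lemma eps_succ (k : ℕ) : 2 * eps H (k + 1) = eps H k := by
  unfold eps; rw [pow_succ]; field_simp

lemma m_pos (hH : 1 ≤ H) (h : 1 ≤ I.logTerm H) (k : ℕ) : 0 < I.m H k := by
  have h1 := eps_pos hH k
  have h2 : (0 : ℝ) < H := by exact_mod_cast hH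
  have h3 : 0 < min (eps H k ^ 2) 1 := lt_min (by positivity) one_pos
  unfold m
  rw [Nat.ceil_pos]
  positivity

lemma θ_pos (hH : 1 ≤ H) (h : 1 ≤ I.logTerm H) (k : ℕ) : 0 < I.θ H k := by
  have : (0 : ℝ) < I.m H k := by exact_mod_cast I.m_pos hH h k
  unfold θ
  positivity

/-- This is the purpose of the choice of `m`. Writing min(ε², 1) as min(ε, 1)² exposes the quantity
q = min(ε, 1) that governs the confidence radius. -/
lemma θ_le (hH : 1 ≤ H) (h : 1 ≤ I.logTerm H) (k : ℕ) :
    I.θ H k ≤ min (eps H k) 1 ^ 2 / (128 * (H : ℝ) ^ 3) := by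
  have h0 : (0 : ℝ) < I.m H k := by exact_mod_cast I.m_pos hH h k
  have h1 := eps_pos hH k
  have h2 : (0 : ℝ) < H := by exact_mod_cast hH
  have hq : min (eps H k ^ 2) 1 = min (eps H k) 1 ^ 2 := by
    rcases le_total (eps H k) 1 with h | h
    · rw [min_eq_left h, min_eq_left (by nlinarith)]
    · rw [min_eq_right h, min_eq_right (by nlinarith), one_pow]
  have h3 : 0 < min (eps H k) 1 := lt_min h1 one_pos
  have h4 : 128 * (H : ℝ) ^ 3 / min (eps H k) 1 ^ 2 * I.logTerm H ≤ I.m H k := by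
    rw [← hq]; exact Nat.le_ceil _
  unfold θ
  rw [div_le_iff₀ h0]
  calc I.logTerm H = min (eps H k) 1 ^ 2 / (128 * (H : ℝ) ^ 3)
        * (128 * (H : ℝ) ^ 3 / min (eps H k) 1 ^ 2 * I.logTerm H) := by field_simp
    _ ≤ _ := mul_le_mul_of_nonneg_left h4 (by positivity)

end SolverInput

/-! ### Union bound over all estimates -/

namespace SolverInput

variable {X A : Type*} [MeasurableSpace X] [MeasurableSpace A] [Fintype A]
  (M : MDP X A) (I : SolverInput X A)

/-- The estimates are accurate outside an event of probability at most `δ`. -/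
lemma answerLaw_not_allAccurate_le [MeasurableSingletonClass X] [Nonempty A]
    (hQm : Measurable I.Q) (hQ : ∀ x, I.Q (I.Q x) = I.Q x) (hS : I.S.Nonempty) (hδ : 0 < I.δ)
    (hδ1 : I.δ < 1) (hdisc : 0 ≤ I.disc) :
    I.answerLaw M.H M.p {ω | ¬ I.AllAccurate M ω} ≤ ENNReal.ofReal I.δ := by
  rcases Nat.eq_zero_or_pos (I.K M.H) with hK | hK
  · have : {ω | ¬ I.AllAccurate M ω} = ∅ := by
      ext ω
      simp only [Set.mem_ofPred_eq, Set.mem_empty_iff_false, iff_false, not_not]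
      intro k hk
      rw [Finset.mem_Icc] at hk
      omega
    rw [this, measure_empty]
    exact zero_le
  have hH := M.one_le_H
  have hlog := I.one_le_logTerm hS hH hK hδ hδ1
  have hlog4 := I.one_le_log_div hS hH hK hδ hδ1 (c := 4) le_rfl
  have hmem : ∀ k : Fin (I.K M.H), (k : ℕ) + 1 ∈ Finset.Icc 1 (I.K M.H) := fun k =>
    Finset.mem_Icc.2 ⟨by omega, by omega⟩
  have hl : 512 * (M.H : ℝ) ^ 2 *
      Real.log (4 * M.H * I.S.card * Fintype.card A * I.K M.H / I.δ) ≤ I.l M.H := Nat.le_ceil _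
  have hH0 : (0 : ℝ) < M.H := by exact_mod_cast hH
  have hl0 : 0 < I.l M.H := by
    have : (0 : ℝ) < I.l M.H := lt_of_lt_of_le (by positivity) hl
    exact_mod_cast this
  have hsub : {ω | ¬ I.AllAccurate M ω} ⊆
      ⋃ j : Fin (I.K M.H) × Finset.Icc 1 M.H × I.S × A,
        ({ω | ¬ I.MeanAccurate M ω (hmem j.1) j.2.1 j.2.2.1 j.2.2.2} ∪
          {ω | ¬ I.IncrAccurate M ω (hmem j.1) j.2.1.2 j.2.2.1 j.2.2.2}) := by
    intro ω hω
    by_contra hcon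
    apply hω
    intro k hk t ht s a
    simp only [Set.mem_iUnion, not_exists, Set.mem_union, Set.mem_ofPred_eq, not_or, not_not]
      at hcon
    exact hcon (⟨k, by rw [Finset.mem_Icc] at hk; omega⟩, ⟨t, ht⟩, s, a)
  have hN := I.one_le_card_mul hS hH hK
  set N : ℝ := M.H * I.S.card * Fintype.card A * I.K M.H with hNdef
  have hN0 : 0 < N := by linarith
  calc I.answerLaw M.H M.p {ω | ¬ I.AllAccurate M ω}
      ≤ ∑ j : Fin (I.K M.H) × Finset.Icc 1 M.H × I.S × A, I.answerLaw M.H M.p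
        ({ω | ¬ I.MeanAccurate M ω (hmem j.1) j.2.1 j.2.2.1 j.2.2.2} ∪
          {ω | ¬ I.IncrAccurate M ω (hmem j.1) j.2.1.2 j.2.2.1 j.2.2.2}) :=
        (measure_mono hsub).trans (measure_iUnion_fintype_le _ _)
    _ ≤ ∑ _j : Fin (I.K M.H) × Finset.Icc 1 M.H × I.S × A, ENNReal.ofReal (I.δ / N) := by
        refine Finset.sum_le_sum fun j _ => (measure_union_le _ _).trans ?_
        have h1 := I.answerLaw_not_meanAccurate_le M hQm hQ (hmem j.1) (I.m_pos hH hlog _)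
          (I.θ_pos hH hlog _) j.2.1 j.2.2.1 j.2.2.2
        have hR : 0 < I.incrRange M.H j.1 := by
          have := eps_pos hH (j.1 + 1)
          unfold incrRange
          positivity
        have h2 := I.answerLaw_not_incrAccurate_le M hQm hQ (hmem j.1) j.2.1.2 hl hl0 hR
          j.2.2.1 j.2.2.2
        rw [I.exp_neg_log_div hS hH hK hδ (by norm_num)] at h2
        rw [logTerm, I.exp_neg_log_div hS hH hK hδ (by norm_num)] at h1
        refine (add_le_add h1 h2).trans ?_
        rw [← ENNReal.ofReal_add (by positivity) (by positivity)]
        apply ENNReal.ofReal_le_ofReal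
        rw [← hNdef]
        -- The constants 16 and 4 inside the logarithms give each index the failure probability
        -- (6/16 + 2/4)δ/N = (7/8)δ/N.
        have e : 6 * (I.δ / (16 * N)) + 2 * (I.δ / (4 * N)) = 7 / 8 * (I.δ / N) := by
          field_simp; ring
        rw [e]
        have : 0 < I.δ / N := by positivity
        linarith
    _ = ENNReal.ofReal I.δ := by
        rw [Finset.sum_const, nsmul_eq_mul, ← ENNReal.ofReal_natCast,
          ← ENNReal.ofReal_mul (by positivity)]
        congr 1
        have : ((Finset.univ : Finset (Fin (I.K M.H) × Finset.Icc 1 M.H × I.S × A)).card : ℝ)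
            = N := by
          rw [Finset.card_univ]
          simp [hNdef]
          ring
        rw [this]
        field_simp

end SolverInput

/-! ### Analysis on the good event -/

lemma sqrt_add_le {x y : ℝ} (hx : 0 ≤ x) (hy : 0 ≤ y) : √(x + y) ≤ √x + √y := by
  apply Real.sqrt_le_iff.2 ⟨by positivity, ?_⟩
  nlinarith [Real.sq_sqrt hx, Real.sq_sqrt hy, Real.sqrt_nonneg x, Real.sqrt_nonneg y,
    mul_nonneg (Real.sqrt_nonneg x) (Real.sqrt_nonneg y)]

lemma rpow_three_quarters_le {y z : ℝ} (hy : 0 ≤ y) (hz : 0 ≤ z) (h : y ^ 3 ≤ z ^ 4) :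
    y ^ (3 / 4 : ℝ) ≤ z := by
  have e1 : y ^ (3 / 4 : ℝ) = (y ^ 3) ^ (1 / 4 : ℝ) := by
    rw [← Real.rpow_natCast, ← Real.rpow_mul hy]; norm_num
  have e2 : z = (z ^ 4) ^ (1 / 4 : ℝ) := by
    rw [← Real.rpow_natCast, ← Real.rpow_mul hz]; norm_num
  rw [e1, e2]
  exact Real.rpow_le_rpow (by positivity) h (by norm_num)

/-- The confidence radius in terms of the variance `σ` of the optimal value function. -/
lemma confidence_radius_le {H q ε η θ σ v : ℝ} (hH : 1 ≤ H) (hq : 0 < q) (hq1 : q ≤ 1)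
    (hqε : q ≤ ε) (hθ : 0 ≤ θ) (hθq : θ ≤ q ^ 2 / (128 * H ^ 3)) (hη : 0 ≤ η)
    (hηH : η ≤ 1 / (16 * H)) (hσ : 0 ≤ σ)
    (hv : √v ≤ √(σ + H ^ 2 * η) + (2 * ε + 12 * η * H ^ 2) / 2) :
    2 * √(2 * θ * v) + (4 / 3 * θ + 4 * (2 * θ) ^ (3 / 4 : ℝ)) * H
      ≤ q / (4 * H ^ 2) * σ + 55 / 96 * (ε / H) + 3 / 2 * η * H := by
  have hH0 : 0 < H := by linarith
  set κ := √(2 * θ) with hκ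
  have hκ0 : 0 ≤ κ := Real.sqrt_nonneg _
  have hκ2 : κ ^ 2 = 2 * θ := Real.sq_sqrt (by positivity)
  have hκ3 : κ ^ 2 ≤ q ^ 2 / (64 * H ^ 3) := by
    rw [hκ2]
    calc 2 * θ ≤ 2 * (q ^ 2 / (128 * H ^ 3)) := by linarith
      _ = _ := by field_simp; norm_num
  have hHpow : H ^ 2 ≤ H ^ 3 := pow_le_pow_right₀ hH (by norm_num)
  have hκq : κ ≤ q / (8 * H) := by
    refine le_of_sq_le_sq (hκ3.trans ?_) (by positivity)
    rw [div_pow]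
    refine div_le_div_of_nonneg_left (by positivity) (by positivity) ?_
    nlinarith
  have hqH : q / H ≤ ε / H := div_le_div_of_nonneg_right hqε hH0.le
  have hεH : 0 < ε / H := div_pos (by linarith) hH0
  -- the three parts of the standard deviation
  have hsplit : √(σ + H ^ 2 * η) ≤ √σ + √(H ^ 2 * η) := sqrt_add_le hσ (by positivity)
  -- Weighted arithmetic-geometric mean inequality. The weight q/(4H²) is the coefficient of the
  -- potential that later absorbs this variance.
  have h1 : 2 * (κ * √σ) ≤ q / (4 * H ^ 2) * σ + 1 / 16 * (ε / H) := by
    have hs := Real.sq_sqrt hσ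
    have h : 0 ≤ (q / (4 * H ^ 2) * √σ - κ) ^ 2 / (q / (4 * H ^ 2)) := by positivity
    have e : (q / (4 * H ^ 2) * √σ - κ) ^ 2 / (q / (4 * H ^ 2))
        = q / (4 * H ^ 2) * (√σ) ^ 2 - 2 * (κ * √σ) + κ ^ 2 * (4 * H ^ 2 / q) := by
      field_simp; ring
    have h2 : κ ^ 2 * (4 * H ^ 2 / q) ≤ 1 / 16 * (q / H) := by
      calc _ ≤ q ^ 2 / (64 * H ^ 3) * (4 * H ^ 2 / q) :=
            mul_le_mul_of_nonneg_right hκ3 (by positivity)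
        _ = _ := by field_simp; norm_num
    rw [e, hs] at h
    linarith
  have h2 : 2 * (κ * √(H ^ 2 * η)) ≤ 1 / 16 * (ε / H) := by
    have : κ * √(H ^ 2 * η) ≤ q / (32 * H) := by
      rw [hκ, ← Real.sqrt_mul (by positivity)]
      apply Real.sqrt_le_iff.2 ⟨by positivity, ?_⟩
      calc 2 * θ * (H ^ 2 * η) ≤ q ^ 2 / (64 * H ^ 3) * (H ^ 2 * (1 / (16 * H))) := by
            rw [← hκ2]; gcongr
        _ = _ := by field_simp; norm_num
    have e : q / (32 * H) = 1 / 32 * (q / H) := by field_simp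
    linarith
  -- The contribution of the distance between the previous iterate and the optimal value. It
  -- requires κ ≤ 1/(8H) even when ε is large, hence the minimum with 1 in the sample size.
  have h3 : κ * (2 * ε + 12 * η * H ^ 2) ≤ 1 / 4 * (ε / H) + 3 / 2 * η * H := by
    have hε : 0 < ε := by linarith
    calc κ * (2 * ε + 12 * η * H ^ 2) ≤ 1 / (8 * H) * (2 * ε + 12 * η * H ^ 2) := by
          refine mul_le_mul_of_nonneg_right (hκq.trans ?_) (by positivity)
          exact div_le_div_of_nonneg_right hq1 (by positivity)
      _ = _ := by field_simp; ring
  have h4 : √(2 * θ * v) = κ * √v := Real.sqrt_mul (by positivity) _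
  have h5 : κ * √v ≤ κ * (√σ + √(H ^ 2 * η) + (2 * ε + 12 * η * H ^ 2) / 2) :=
    mul_le_mul_of_nonneg_left (by linarith) hκ0
  -- Here 3/64 is a rational upper bound for 64^(-3/4).
  have h6 : (2 * θ) ^ (3 / 4 : ℝ) ≤ 3 * q / (64 * H ^ 2) := by
    refine rpow_three_quarters_le (by positivity) (by positivity) ?_
    rw [← hκ2]
    calc (κ ^ 2) ^ 3 ≤ (q ^ 2 / (64 * H ^ 3)) ^ 3 := pow_le_pow_left₀ (sq_nonneg _) hκ3 3
      _ = q ^ 4 / (64 ^ 3 * H ^ 8) * (q ^ 2 / H) := by field_simp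
      _ ≤ q ^ 4 / (64 ^ 3 * H ^ 8) * 1 := by
          refine mul_le_mul_of_nonneg_left ?_ (by positivity)
          rw [div_le_one hH0]
          nlinarith
      _ ≤ (3 * q / (64 * H ^ 2)) ^ 4 := by
          have : (3 * q / (64 * H ^ 2)) ^ 4 = q ^ 4 / (64 ^ 3 * H ^ 8) * (81 / 64) := by
            field_simp; norm_num
          rw [this]
          exact mul_le_mul_of_nonneg_left (by norm_num) (by positivity)
  have h7 : 4 * (2 * θ) ^ (3 / 4 : ℝ) * H ≤ 3 / 16 * (ε / H) := by
    have : 4 * (3 * q / (64 * H ^ 2)) * H = 3 / 16 * (q / H) := by field_simp; norm_num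
    have h : 4 * (2 * θ) ^ (3 / 4 : ℝ) * H ≤ 4 * (3 * q / (64 * H ^ 2)) * H := by gcongr
    linarith
  have h8 : 4 / 3 * θ * H ≤ 1 / 96 * (ε / H) := by
    have : 4 / 3 * θ * H ≤ 4 / 3 * (q ^ 2 / (128 * H ^ 3)) * H := by gcongr
    have e : 4 / 3 * (q ^ 2 / (128 * H ^ 3)) * H = 1 / 96 * (q / H) * (q / H) := by
      field_simp; norm_num
    have hqH1 : q / H ≤ 1 := by rw [div_le_one hH0]; linarith
    have hqH0 : 0 < q / H := by positivity
    nlinarith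
  -- The coefficients of ε/H add up as (6 + 6 + 24 + 18 + 1)/96 = 55/96.
  rw [h4]
  nlinarith

namespace SolverInput

variable {X A : Type*} [MeasurableSpace X] [MeasurableSpace A] (M : MDP X A) (I : SolverInput X A)

/-- Rewards and transition probabilities vary by at most `I.disc` within a cell. -/
structure CellRegular : Prop where
  reward : ∀ x a, |M.r x a - M.r (I.Q x) a| ≤ I.disc
  kernel : ∀ x a, tvDist (M.p (x, a)) (M.p (I.Q x, a)) ≤ I.disc

variable {M I}

lemma CellRegular.disc_nonneg [Nonempty X] [Nonempty A] (h : I.CellRegular M) : 0 ≤ I.disc :=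
  (abs_nonneg _).trans (h.reward (Classical.arbitrary X) (Classical.arbitrary A))

lemma CellRegular.abs_integral_sub_le (h : I.CellRegular M) {f : X → ℝ} (hf : Measurable f) {b : ℝ}
    (hb : 0 ≤ b) (hfb : ∀ x, f x ∈ Set.Icc 0 b) (x : X) (a : A) :
    |∫ y, f y ∂M.p (x, a) - ∫ y, f y ∂M.p (I.Q x, a)| ≤ b * I.disc :=
  (abs_integral_sub_le_tvDist _ _ hf hb hfb).trans
    (mul_le_mul_of_nonneg_left (h.kernel x a) hb)

lemma CellRegular.popVar_le (h : I.CellRegular M) {f : X → ℝ} (hf : Measurable f) {b : ℝ}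
    (hb : 0 ≤ b) (hfb : ∀ x, f x ∈ Set.Icc 0 b) (x : X) (a : A) :
    popVar (M.p (I.Q x, a)) f ≤ popVar (M.p (x, a)) f + b ^ 2 * I.disc := by
  have hsymm : tvDist (M.p (I.Q x, a)) (M.p (x, a)) = tvDist (M.p (x, a)) (M.p (I.Q x, a)) := by
    simp only [tvDist, abs_sub_comm]
  have := popVar_le_add_tvDist (M.p (I.Q x, a)) (M.p (x, a)) hf hb hfb
  rw [hsymm] at this
  linarith [mul_le_mul_of_nonneg_left (h.kernel x a) (sq_nonneg b)]

variable [Fintype A] (M I)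

/-- Guarantees after `k` epochs: the iterates are subsolutions of the Bellman equations of the
current policy, and they are close to the optimal values. -/
structure EpochInvariant (ω : I.Call M.H → X) (k : ℕ) : Prop where
  subsolution : ∀ t ∈ Finset.Icc 1 M.H, ∀ x,
    I.u M.H M.r ω k t x ≤ M.lookahead (I.u M.H M.r ω k (t + 1)) x (I.pol M.H M.r ω k t x)
  lower : ∀ t ∈ Finset.Icc 1 M.H, ∀ x,
    M.bellmanAt t x - eps M.H k - 12 * I.disc * M.H ^ 2 ≤ I.u M.H M.r ω k t x

variable {M I}

lemma measurable_u_apply [MeasurableSingletonClass X] (hQm : Measurable I.Q) (ω : I.Call M.H → X)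
    (k t : ℕ) : Measurable (I.u M.H M.r ω k t) :=
  (I.measurable_u M.H M.r hQm k t).comp (measurable_const.prodMk measurable_id)

lemma bellmanAt_mem_Icc_horizon [Nonempty A] {t : ℕ} (ht : 1 ≤ t) (x : X) :
    M.bellmanAt t x ∈ Set.Icc (0 : ℝ) M.H := by
  have h := M.bellmanAt_mem_Icc t x
  refine ⟨h.1, h.2.trans ?_⟩
  exact_mod_cast (by omega : M.H + 1 - t ≤ M.H)

lemma lookahead_bellmanAt_le {t : ℕ} (ht : t ≤ M.H) (x : X) (a : A) :
    M.lookahead (M.bellmanAt (t + 1)) x a ≤ M.bellmanAt t x := by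
  have := M.lookahead_le_bellman_succ (M.H - t) x a
  rwa [MDP.bellmanAt, MDP.bellmanAt, show M.H + 1 - t = M.H - t + 1 by omega,
    show M.H + 1 - (t + 1) = M.H - t by omega]

/-- Subsolutions of the Bellman equations of a policy lie below its value functions. -/
lemma EpochInvariant.u_le_value [MeasurableSingletonClass X] [MeasurableSingletonClass A]
    {ω : I.Call M.H → X} {k : ℕ} (h : I.EpochInvariant M ω k) (hQm : Measurable I.Q)
    (hQ : ∀ x, I.Q (I.Q x) = I.Q x)
    (hπ : ∀ t, Measurable (I.pol M.H M.r ω k t)) (t : ℕ) (ht : 1 ≤ t) (x : X) :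
    I.u M.H M.r ω k t x ≤ M.value (Policy.det (I.pol M.H M.r ω k) hπ) t x := by
  by_cases htH : t ≤ M.H
  · have ih := fun y => h.u_le_value hQm hQ hπ (t + 1) (by omega) y
    have hmem : t ∈ Finset.Icc 1 M.H := Finset.mem_Icc.2 ⟨ht, htH⟩
    refine (h.subsolution t hmem x).trans ?_
    rw [MDP.value_det _ _ htH]
    obtain ⟨B, hB⟩ := I.exists_abs_u_le M.H M.r hQ ω k (t + 1)
    refine M.lookahead_mono (measurable_u_apply hQm ω k (t + 1)) (M.measurable_value _ _) hB
      (C := ((M.H + 1 - (t + 1) : ℕ) : ℝ)) (fun y => ?_) ih x _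
    have := M.value_mem_Icc (Policy.det (I.pol M.H M.r ω k) hπ) (t + 1) y
    rw [abs_of_nonneg this.1]
    exact this.2
  · rw [u_of_notMem _ _ _ _ _ (by rw [Finset.mem_Icc]; omega), MDP.value_of_lt _ _ (by omega)]
    exact le_rfl
termination_by M.H + 1 - t

/-- On the good event, scores estimate one-step lookaheads from below. -/
lemma score_bounds [MeasurableSingletonClass X] (hQm : Measurable I.Q)
    (hQ : ∀ x, I.Q (I.Q x) = I.Q x) (hdisc : 0 ≤ I.disc)
    {ω : I.Call M.H → X} (hacc : I.AllAccurate M ω) {k : ℕ}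
    (hk : k + 1 ∈ Finset.Icc 1 (I.K M.H)) {t : ℕ} (ht : t ∈ Finset.Icc 1 M.H)
    (hu : ∀ x, I.u M.H M.r ω k (t + 1) x ≤ M.H)
    (hd : ∀ x, I.u M.H M.r ω (k + 1) (t + 1) x - I.u M.H M.r ω k (t + 1) x ≤ I.incrRange M.H k)
    (x : X) (a : A) :
    I.cellScore M.H M.r (k + 1) (I.u M.H M.r ω k) (I.batch M.H ω hk) (I.freshBatch M.H ω hk) ht x a
        ≤ M.lookahead (I.u M.H M.r ω (k + 1) (t + 1)) (I.Q x) a - I.disc * M.H ∧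
      M.lookahead (I.u M.H M.r ω (k + 1) (t + 1)) (I.Q x) a
          - (2 * √(2 * I.θ M.H (k + 1)
              * popVar (M.p (I.Q x, a)) (I.u M.H M.r ω k (t + 1)))
            + (4 / 3 * I.θ M.H (k + 1) + 4 * (2 * I.θ M.H (k + 1)) ^ (3 / 4 : ℝ)) * M.H)
          - 23 / 8 * I.disc * M.H - 5 / 16 * (eps M.H (k + 1) / M.H)
        ≤ I.cellScore M.H M.r (k + 1) (I.u M.H M.r ω k) (I.batch M.H ω hk)
          (I.freshBatch M.H ω hk) ht x a := by
  have hH : (0 : ℝ) < M.H := by exact_mod_cast M.one_le_H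
  obtain ⟨hmean, hincr⟩ := hacc k hk t ht (I.Q x) a
  obtain ⟨hm1, hm2⟩ := hmean fun s' => ⟨I.u_nonneg M.H M.r hQ ω k (t + 1) s', hu s'⟩
  have hi := abs_le.1 (hincr fun s' =>
    ⟨sub_nonneg.2 (I.u_le_u_succ M.H M.r hQ ω k (t + 1) s'), hd s'⟩)
  obtain ⟨B, hB⟩ := I.exists_abs_u_le M.H M.r hQ ω k (t + 1)
  obtain ⟨C, hC⟩ := I.exists_abs_u_le M.H M.r hQ ω (k + 1) (t + 1)
  rw [integral_sub (integrable_of_bounded (measurable_u_apply hQm ω _ _) hC)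
    (integrable_of_bounded (measurable_u_apply hQm ω _ _) hB)] at hi
  -- The shift built into `betaHat` is four times this tolerance, so the estimate of the increment
  -- errs downwards. From below the losses are 1/16 + 1/4 = 5/16 and, with the shift in `muHat`, 3/8
  -- + 3/2 + 1 = 23/8.
  have hR : I.incrRange M.H k / (32 * M.H)
      = 1 / 16 * (eps M.H (k + 1) / M.H) + 3 / 8 * I.disc * M.H := by
    unfold incrRange; field_simp; ring
  have hE : eps M.H (k + 1) / (4 * M.H) = 1 / 4 * (eps M.H (k + 1) / M.H) := by
    field_simp
  have hE0 : 0 < eps M.H (k + 1) / M.H := div_pos (eps_pos M.one_le_H _) hH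
  have hdH : 0 ≤ I.disc * M.H := by positivity
  rw [hR] at hi
  rw [cellScore, score, betaHat, hE, MDP.lookahead, ← u_succ _ _ _ _ hk]
  constructor <;> linarith [hi.1, hi.2]

lemma abs_lookahead_sub_cell_le [MeasurableSingletonClass X] (hQm : Measurable I.Q) (hQ : ∀ x, I.Q (I.Q x) = I.Q x)
    (hreg : I.CellRegular M) {ω : I.Call M.H → X} {k t : ℕ}
    (hu : ∀ x, I.u M.H M.r ω k t x ≤ M.H) (x : X) (a : A) :
    |M.lookahead (I.u M.H M.r ω k t) x a - M.lookahead (I.u M.H M.r ω k t) (I.Q x) a|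
      ≤ I.disc + I.disc * M.H := by
  have h1 := abs_le.1 (hreg.reward x a)
  have h2 := abs_le.1 (hreg.abs_integral_sub_le (measurable_u_apply hQm ω k t)
    (b := M.H) (Nat.cast_nonneg _) (fun y => ⟨I.u_nonneg M.H M.r hQ ω k t y, hu y⟩) x a)
  rw [MDP.lookahead, MDP.lookahead, abs_le]
  constructor <;> linarith [h1.1, h1.2, h2.1, h2.2]

/-- Increments of an epoch stay in the allowed range as long as the new iterate is below the
optimal value. -/
lemma EpochInvariant.incr_le (hQ : ∀ x, I.Q (I.Q x) = I.Q x) (hdisc : 0 ≤ I.disc)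
    {ω : I.Call M.H → X} {k : ℕ} (h : I.EpochInvariant M ω k) {t : ℕ} (ht : 1 ≤ t) (x : X) :
    M.bellmanAt t x - I.u M.H M.r ω k t x ≤ I.incrRange M.H k := by
  have hE0 := eps_pos M.one_le_H k
  rw [incrRange, eps_succ]
  by_cases htH : t ≤ M.H
  · linarith [h.lower t (Finset.mem_Icc.2 ⟨ht, htH⟩) x]
  · rw [M.bellmanAt_of_lt (by omega)]
    have := I.u_nonneg M.H M.r hQ ω k t x
    have : 0 ≤ 12 * I.disc * (M.H : ℝ) ^ 2 := by positivity
    linarith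

lemma epochInvariant_zero [Nonempty A] (hdisc : 0 ≤ I.disc) (ω : I.Call M.H → X) : I.EpochInvariant M ω 0 where
  subsolution t ht x := by
    simpa [u_zero, MDP.lookahead] using (M.r_mem x _).1
  lower t ht x := by
    have h := (bellmanAt_mem_Icc_horizon (M := M) (Finset.mem_Icc.1 ht).1 x).2
    have : 0 ≤ 12 * I.disc * (M.H : ℝ) ^ 2 := by positivity
    simp only [u_zero, eps, pow_zero, div_one, Pi.zero_apply]
    linarith

/-! ### Induction over epochs -/

section Step

variable [MeasurableSingletonClass X] [Nonempty X] [Nonempty A]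

/-- One epoch preserves the subsolution property, and keeps the iterates below the optimal value. -/
lemma EpochInvariant.succ_subsolution (hQm : Measurable I.Q) (hQ : ∀ x, I.Q (I.Q x) = I.Q x)
    (hreg : I.CellRegular M) (hmax : ∀ (f : A → ℝ) (a : A), f a ≤ f (I.argmax f))
    {ω : I.Call M.H → X} (hacc : I.AllAccurate M ω) {k : ℕ}
    (hk : k + 1 ∈ Finset.Icc 1 (I.K M.H)) (h : I.EpochInvariant M ω k) (t : ℕ) (ht : 1 ≤ t) :
    (∀ x, I.u M.H M.r ω (k + 1) t x ≤ M.bellmanAt t x) ∧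
      (t ≤ M.H → ∀ x, I.u M.H M.r ω (k + 1) t x
        ≤ M.lookahead (I.u M.H M.r ω (k + 1) (t + 1)) x (I.pol M.H M.r ω (k + 1) t x)) := by
  by_cases htH : t ≤ M.H
  · have ih := (succ_subsolution hQm hQ hreg hmax hacc hk h (t + 1) (by omega)).1
    have hmem : t ∈ Finset.Icc 1 M.H := Finset.mem_Icc.2 ⟨ht, htH⟩
    have hdisc := hreg.disc_nonneg
    have hW : ∀ x, M.bellmanAt (t + 1) x ≤ M.H := fun x =>
      (bellmanAt_mem_Icc_horizon (by omega) x).2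
    have hu' : ∀ x, I.u M.H M.r ω (k + 1) (t + 1) x ≤ M.H := fun x => (ih x).trans (hW x)
    obtain ⟨B, hB⟩ := I.exists_abs_u_le M.H M.r hQ ω k (t + 1)
    obtain ⟨C, hC⟩ := I.exists_abs_u_le M.H M.r hQ ω (k + 1) (t + 1)
    have hsub : ∀ x, I.u M.H M.r ω (k + 1) t x
        ≤ M.lookahead (I.u M.H M.r ω (k + 1) (t + 1)) x (I.pol M.H M.r ω (k + 1) t x) := by
      intro x
      have hcases := I.epoch_step_cases M.H M.r (k + 1) (v := I.u M.H M.r ω k)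
        (I.pol M.H M.r ω k) (I.batch M.H ω hk) (I.freshBatch M.H ω hk) hmax hmem x
      rw [← u_succ _ _ _ _ hk, ← pol_succ _ _ _ _ hk] at hcases
      rcases hcases with ⟨h1, h2⟩ | h1
      · rw [h1, h2]
        refine (h.subsolution t hmem x).trans ?_
        exact M.lookahead_mono (measurable_u_apply hQm ω _ _) (measurable_u_apply hQm ω _ _) hB hC
          (fun y => I.u_le_u_succ M.H M.r hQ ω k (t + 1) y) x _
      · set a := I.pol M.H M.r ω (k + 1) t x
        -- The score lies below the lookahead at the cell centre by a margin ηH, and the candidate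
        -- is lowered by a further η. Together these pay for moving from the centre to x.
        have hs := (score_bounds hQm hQ hdisc hacc hk hmem
          (fun y => (I.u_le_u_succ M.H M.r hQ ω k (t + 1) y).trans (hu' y))
          (fun y => (sub_le_sub_right (ih y) _).trans (h.incr_le hQ hdisc (by omega) y)) x a).1
        have hc := abs_le.1 (abs_lookahead_sub_cell_le hQm hQ hreg hu' x a)
        rw [h1]
        linarith [hc.1]
    refine ⟨fun x => (hsub x).trans (le_trans ?_ (lookahead_bellmanAt_le htH x
      (I.pol M.H M.r ω (k + 1) t x))), fun _ => hsub⟩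
    exact M.lookahead_mono (measurable_u_apply hQm ω _ _) (M.measurable_bellmanAt _) hC
      (C := M.H) (fun y => by
        rw [abs_of_nonneg (M.bellmanAt_mem_Icc (t + 1) y).1]; exact hW y) ih x _
  · refine ⟨fun x => ?_, fun h => absurd h htH⟩
    rw [u_of_notMem _ _ _ _ _ (by rw [Finset.mem_Icc]; omega), M.bellmanAt_of_lt (by omega)]
    exact le_rfl
termination_by M.H + 1 - t

/-- Per-step error of an epoch. -/
noncomputable def stepError (H k : ℕ) : ℝ :=
  2 * I.disc + 43 / 8 * I.disc * H + 85 / 96 * (eps H (k + 1) / H)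

/-- Backward propagation of the error, with a potential that absorbs the total variance. -/
lemma EpochInvariant.succ_error (hQm : Measurable I.Q) (hQ : ∀ x, I.Q (I.Q x) = I.Q x)
    (hreg : I.CellRegular M) (hmax : ∀ (f : A → ℝ) (a : A), f a ≤ f (I.argmax f))
    (hdiscH : I.disc ≤ 1 / (16 * M.H)) (hlog : 1 ≤ I.logTerm M.H)
    {ω : I.Call M.H → X} (hacc : I.AllAccurate M ω) {k : ℕ}
    (hk : k + 1 ∈ Finset.Icc 1 (I.K M.H)) (h : I.EpochInvariant M ω k)
    (j t : ℕ) (ht : 1 ≤ t) (hjt : t + j = M.H + 1) (x : X) :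
    M.bellmanAt t x - I.u M.H M.r ω (k + 1) t x ≤ j * I.stepError M.H k
      + min (eps M.H (k + 1)) 1 / (4 * (M.H : ℝ) ^ 2)
        * (M.bellmanAt t x * (j - M.bellmanAt t x)) := by
  induction j generalizing t x with
  | zero =>
    rw [u_of_notMem _ _ _ _ _ (by rw [Finset.mem_Icc]; omega), M.bellmanAt_of_lt (by omega)]
    simp
  | succ j ih =>
    have htH : t ≤ M.H := by omega
    have ih := fun y => ih (t + 1) (by omega) (by omega) y
    have hmem : t ∈ Finset.Icc 1 M.H := Finset.mem_Icc.2 ⟨ht, htH⟩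
    have hdisc := hreg.disc_nonneg
    have hH1 : (1 : ℝ) ≤ M.H := by exact_mod_cast M.one_le_H
    have hup := (h.succ_subsolution hQm hQ hreg hmax hacc hk (t + 1) (by omega)).1
    -- An action optimal for the Bellman equation, not the one the algorithm selects: the new value
    -- dominates every lowered score, and this choice keeps the recursion on optimal values.
    obtain ⟨a, ha⟩ := M.exists_bellmanAt_eq htH x
    have hWm := M.measurable_bellmanAt (t + 1)
    have hWr : ∀ y, M.bellmanAt (t + 1) y ∈ Set.Icc (0 : ℝ) M.H := fun y =>
      bellmanAt_mem_Icc_horizon (by omega) y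
    have hWj : ∀ y, M.bellmanAt (t + 1) y ∈ Set.Icc (0 : ℝ) j := fun y => by
      have := M.bellmanAt_mem_Icc (t + 1) y
      rwa [show M.H + 1 - (t + 1) = j by omega] at this
    have hWabs : ∀ y, |M.bellmanAt (t + 1) y| ≤ M.H := fun y => by
      rw [abs_of_nonneg (hWr y).1]; exact (hWr y).2
    have hu' : ∀ y, I.u M.H M.r ω (k + 1) (t + 1) y ≤ M.H := fun y => (hup y).trans (hWr y).2
    have hmono := fun y => I.u_le_u_succ M.H M.r hQ ω k (t + 1) y
    have hu : ∀ y, I.u M.H M.r ω k (t + 1) y ≤ M.H := fun y => (hmono y).trans (hu' y)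
    have hs := (score_bounds hQm hQ hdisc hacc hk hmem hu
      (fun y => (sub_le_sub_right (hup y) _).trans (h.incr_le hQ hdisc (by omega) y)) x a).2
    have hc := (abs_le.1 (abs_lookahead_sub_cell_le hQm hQ hreg hu' x a)).2
    have hval := I.cellScore_sub_disc_le_epochValue M.H M.r (k + 1) (v := I.u M.H M.r ω k)
      (I.batch M.H ω hk) (I.freshBatch M.H ω hk) (I.u_factor M.H M.r hQ ω k) hmem x a
    rw [← u_succ _ _ _ _ hk] at hval
    set W := M.bellmanAt (t + 1) with hW
    set u' := I.u M.H M.r ω (k + 1) (t + 1) with hu'def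
    set v := I.u M.H M.r ω k (t + 1) with hvdef
    set q := min (eps M.H (k + 1)) 1 with hq
    have hE0 := eps_pos M.one_le_H (k + 1)
    have hq0 : 0 < q := lt_min hE0 one_pos
    have hum := measurable_u_apply (M := M) (I := I) hQm ω (k + 1) (t + 1)
    have hvm := measurable_u_apply (M := M) (I := I) hQm ω k (t + 1)
    have huabs : ∀ y, |u' y| ≤ M.H := fun y => by
      rw [abs_of_nonneg (I.u_nonneg M.H M.r hQ ω _ _ y)]; exact hu' y
    have hvabs : ∀ y, |v y| ≤ M.H := fun y => by
      rw [abs_of_nonneg (I.u_nonneg M.H M.r hQ ω _ _ y)]; exact hu y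
    -- standard deviations
    have hsd : √(popVar (M.p (I.Q x, a)) v) ≤ √(popVar (M.p (x, a)) W + (M.H : ℝ) ^ 2 * I.disc)
        + (2 * eps M.H (k + 1) + 12 * I.disc * M.H ^ 2) / 2 := by
      refine (sqrt_popVar_le_add hvm hWm hvabs hWabs).trans (add_le_add ?_ ?_)
      · exact Real.sqrt_le_sqrt (hreg.popVar_le hWm (Nat.cast_nonneg _) hWr x a)
      · have hE1 := eps_pos M.one_le_H (k + 1)
        apply Real.sqrt_le_iff.2 ⟨by positivity, ?_⟩
        refine popVar_le_sq_div_four (hWm.sub hvm) fun y => ⟨?_, ?_⟩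
        · exact sub_nonneg.2 ((hmono y).trans (hup y))
        · exact h.incr_le hQ hdisc (by omega) y
    have hrad := confidence_radius_le hH1 hq0 (min_le_right _ _) (min_le_left _ _)
      (I.θ_pos M.one_le_H hlog (k + 1)).le (I.θ_le M.one_le_H hlog (k + 1)) hdisc hdiscH
      (popVar_nonneg (ν := M.p (x, a)) hWm hWabs) hsd
    -- propagation through the transition kernel
    have hWi := integrable_of_bounded (ν := M.p (x, a)) hWm hWabs
    have hui := integrable_of_bounded (ν := M.p (x, a)) hum huabs
    have hW2i : Integrable (fun y => W y ^ 2) (M.p (x, a)) :=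
      integrable_of_bounded (hWm.pow_const 2) (B := (M.H : ℝ) ^ 2) fun y => by
        rw [abs_pow]; exact pow_le_pow_left₀ (abs_nonneg _) (hWabs y) 2
    have hprop : ∫ y, W y ∂M.p (x, a) - ∫ y, u' y ∂M.p (x, a) ≤ j * I.stepError M.H k
        + q / (4 * (M.H : ℝ) ^ 2)
          * (j * ∫ y, W y ∂M.p (x, a) - ∫ y, W y ^ 2 ∂M.p (x, a)) := by
      rw [← integral_sub hWi hui]
      have hi : Integrable (fun y => j * W y - W y ^ 2) (M.p (x, a)) := (hWi.const_mul _).sub hW2i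
      calc _ ≤ ∫ y, (j * I.stepError M.H k + q / (4 * (M.H : ℝ) ^ 2) * (j * W y - W y ^ 2))
            ∂M.p (x, a) := by
            refine integral_mono (hWi.sub hui) ((integrable_const _).add (hi.const_mul _))
              fun y => ?_
            have := ih y
            have e : W y * (j - W y) = j * W y - W y ^ 2 := by ring
            simp only
            rw [← e]
            exact this
        _ = _ := by
            rw [integral_add (integrable_const _) (hi.const_mul _),
              integral_const_mul (q / (4 * (M.H : ℝ) ^ 2)), integral_sub (hWi.const_mul _) hW2i,
              integral_const_mul (j : ℝ) W]
            simp
    have hP := integral_mem_Icc_of_mem_Icc (ν := M.p (x, a)) hWm hWj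
    have hr := M.r_mem x a
    rw [show popVar (M.p (x, a)) W = ∫ y, W y ^ 2 ∂M.p (x, a) - (∫ y, W y ∂M.p (x, a)) ^ 2
      from rfl] at hrad
    simp only [MDP.lookahead] at ha hs hc
    set PW := ∫ y, W y ∂M.p (x, a)
    set PW2 := ∫ y, W y ^ 2 ∂M.p (x, a)
    set lam := q / (4 * (M.H : ℝ) ^ 2) with hlam
    have hlam0 : 0 < lam := by positivity
    -- The induction hypothesis contributes jPW - PW2 and the radius contributes the variance PW2 -
    -- PW². In the sum the second moment cancels, leaving PW(j - PW). With W_t = r + PW, the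
    -- difference of the two sides is r(j - PW) + (1 - r)(r + PW).
    have hpot : PW * (j - PW) ≤ M.bellmanAt t x * ((j + 1 : ℕ) - M.bellmanAt t x) := by
      rw [ha]
      push_cast
      have h1 : 0 ≤ M.r x a * (j - PW) := mul_nonneg hr.1 (by linarith [hP.2])
      have h2 : 0 ≤ (1 - M.r x a) * (M.r x a + PW) :=
        mul_nonneg (by linarith [hr.2]) (by linarith [hr.1, hP.1])
      nlinarith
    have hpot' := mul_le_mul_of_nonneg_left hpot hlam0.le
    -- Here 43/8 = 23/8 + 3/2 + 1 collects scores, radius and change of kernel; 85/96 = 5/16 +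
    -- 55/96; the two single η come from the rewards and from the lowering of c.
    have hse : I.stepError M.H k
        = 2 * I.disc + 43 / 8 * I.disc * M.H + 85 / 96 * (eps M.H (k + 1) / M.H) := rfl
    push_cast at hpot' ⊢
    linarith

/-- The guarantees carry over from one epoch to the next. -/
lemma EpochInvariant.succ (hQm : Measurable I.Q) (hQ : ∀ x, I.Q (I.Q x) = I.Q x)
    (hreg : I.CellRegular M) (hmax : ∀ (f : A → ℝ) (a : A), f a ≤ f (I.argmax f))
    (hdiscH : I.disc ≤ 1 / (16 * M.H)) (hlog : 1 ≤ I.logTerm M.H)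
    {ω : I.Call M.H → X} (hacc : I.AllAccurate M ω) {k : ℕ}
    (hk : k + 1 ∈ Finset.Icc 1 (I.K M.H)) (h : I.EpochInvariant M ω k) :
    I.EpochInvariant M ω (k + 1) where
  subsolution t ht x :=
    (h.succ_subsolution hQm hQ hreg hmax hacc hk t (Finset.mem_Icc.1 ht).1).2
      (Finset.mem_Icc.1 ht).2 x
  lower t ht x := by
    obtain ⟨ht1, htH⟩ := Finset.mem_Icc.1 ht
    have herr := h.succ_error hQm hQ hreg hmax hdiscH hlog hacc hk (M.H + 1 - t) t ht1
      (by omega) x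
    set j := M.H + 1 - t
    have hdisc := hreg.disc_nonneg
    have hH1 : (1 : ℝ) ≤ M.H := by exact_mod_cast M.one_le_H
    have hjH : (j : ℝ) ≤ M.H := by exact_mod_cast (by omega : j ≤ M.H)
    have hE0 := eps_pos M.one_le_H (k + 1)
    have hse : 0 ≤ I.stepError M.H k := by unfold stepError; positivity
    have h1 : j * I.stepError M.H k ≤ M.H * I.stepError M.H k :=
      mul_le_mul_of_nonneg_right hjH hse
    have e1 : M.H * I.stepError M.H k
        = 2 * I.disc * M.H + 43 / 8 * I.disc * M.H ^ 2 + 85 / 96 * eps M.H (k + 1) := by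
      unfold stepError; field_simp
    have h2 : M.bellmanAt t x * (j - M.bellmanAt t x) ≤ (M.H : ℝ) ^ 2 / 4 := by
      have hj0 : (0 : ℝ) ≤ j := Nat.cast_nonneg _
      nlinarith [sq_nonneg (M.bellmanAt t x - j / 2)]
    have h3 : min (eps M.H (k + 1)) 1 / (4 * (M.H : ℝ) ^ 2)
        * (M.bellmanAt t x * (j - M.bellmanAt t x)) ≤ 1 / 16 * eps M.H (k + 1) := by
      have hq0 : 0 < min (eps M.H (k + 1)) 1 := lt_min hE0 one_pos
      calc _ ≤ min (eps M.H (k + 1)) 1 / (4 * (M.H : ℝ) ^ 2) * ((M.H : ℝ) ^ 2 / 4) :=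
            mul_le_mul_of_nonneg_left h2 (by positivity)
        _ = 1 / 16 * min (eps M.H (k + 1)) 1 := by field_simp; norm_num
        _ ≤ _ := by linarith [min_le_left (eps M.H (k + 1)) 1]
    have h4 : I.disc * M.H ≤ I.disc * (M.H : ℝ) ^ 2 := by
      refine mul_le_mul_of_nonneg_left ?_ hdisc
      nlinarith
    have h5 : 0 ≤ I.disc * (M.H : ℝ) ^ 2 := by positivity
    -- The totals are (85 + 6)/96 of the target accuracy and at most (2 + 43/8)ηH², both within the
    -- allowance.
    linarith

/-- On the good event all epochs keep their guarantees. -/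
lemma AllAccurate.epochInvariant (hQm : Measurable I.Q) (hQ : ∀ x, I.Q (I.Q x) = I.Q x)
    (hreg : I.CellRegular M) (hmax : ∀ (f : A → ℝ) (a : A), f a ≤ f (I.argmax f))
    (hdiscH : I.disc ≤ 1 / (16 * M.H)) (hlog : 1 ≤ I.K M.H → 1 ≤ I.logTerm M.H)
    {ω : I.Call M.H → X} (hacc : I.AllAccurate M ω) {k : ℕ} (hk : k ≤ I.K M.H) :
    I.EpochInvariant M ω k := by
  induction k with
  | zero => exact epochInvariant_zero hreg.disc_nonneg ω
  | succ k ih =>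
    exact (ih (by omega)).succ hQm hQ hreg hmax hdiscH (hlog (by omega)) hacc
      (Finset.mem_Icc.2 ⟨by omega, hk⟩)

end Step

end SolverInput

/-! ### Number of epochs and of oracle calls -/

namespace SolverInput

variable {X A : Type*} (I : SolverInput X A) {H : ℕ}

lemma eps_K_le (hH : 1 ≤ H) (hε : 0 < I.ε) : eps H (I.K H) ≤ I.ε := by
  have hH0 : (0 : ℝ) < H := by exact_mod_cast hH
  have h1 : Real.logb 2 (H / I.ε) ≤ I.K H := Nat.le_ceil _
  rw [Real.logb_le_iff_le_rpow (by norm_num) (by positivity), Real.rpow_natCast,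
    div_le_iff₀ hε] at h1
  rw [eps, div_le_iff₀ (by positivity)]
  linarith

/-- Since 3 log 2 > 2. The resulting slack absorbs the rounding in the number of epochs and the
numerical factors inside logarithms. -/
lemma log_div_ge (hε : 0 < I.ε) (hεH : I.ε ≤ H / 8) : 2 ≤ Real.log (H / I.ε) := by
  have h8 : (8 : ℝ) ≤ H / I.ε := by rw [le_div_iff₀ hε]; linarith
  have h1 : Real.log 8 = 3 * Real.log 2 := by
    rw [show (8 : ℝ) = 2 ^ 3 by norm_num, Real.log_pow]; norm_num
  have := Real.log_two_gt_d9
  have := Real.log_le_log (by norm_num) h8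
  linarith

lemma K_le (hε : 0 < I.ε) (hεH : I.ε ≤ H / 8) : (I.K H : ℝ) ≤ 2 * Real.log (H / I.ε) := by
  have hy := I.log_div_ge hε hεH
  have h2 := Real.log_two_gt_d9
  have h0 : 0 ≤ Real.logb 2 (H / I.ε) := div_nonneg (by linarith) (by linarith)
  have h1 : (I.K H : ℝ) < Real.logb 2 (H / I.ε) + 1 := Nat.ceil_lt_add_one h0
  have h3 : Real.logb 2 (H / I.ε) ≤ 3 / 2 * Real.log (H / I.ε) := by
    rw [Real.logb, div_le_iff₀ (by linarith)]
    nlinarith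
  linarith

lemma one_le_K (hε : 0 < I.ε) (hεH : I.ε ≤ H / 8) : 1 ≤ I.K H := by
  have hy := I.log_div_ge hε hεH
  have h2 := Real.log_two_gt_d9
  exact Nat.ceil_pos.2 (div_pos (by linarith) (by linarith))

lemma two_pow_K_le (hε : 0 < I.ε) (hεH : I.ε ≤ H / 8) : (2 : ℝ) ^ I.K H ≤ 2 * (H / I.ε) := by
  have hy := I.log_div_ge hε hεH
  have h2 := Real.log_two_gt_d9
  have hHε : (0 : ℝ) < H / I.ε := by
    have : (8 : ℝ) ≤ H / I.ε := by rw [le_div_iff₀ hε]; linarith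
    linarith
  have h0 : 0 ≤ Real.logb 2 (H / I.ε) := div_nonneg (by linarith) (by linarith)
  have h1 : (I.K H : ℝ) < Real.logb 2 (H / I.ε) + 1 := Nat.ceil_lt_add_one h0
  rw [← Real.rpow_natCast]
  calc (2 : ℝ) ^ (I.K H : ℝ) ≤ 2 ^ (Real.logb 2 (H / I.ε) + 1) :=
        Real.rpow_le_rpow_of_exponent_le (by norm_num) h1.le
    _ = 2 * (H / I.ε) := by
        rw [Real.rpow_add (by norm_num), Real.rpow_logb (by norm_num) (by norm_num) hHε,
          Real.rpow_one]
        ring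

/-- Bounding 1/min(ε_k², 1) by 1/ε_k² + 1 leaves a geometric sum of ratio 4, dominated by the last
epoch, and one unit per epoch. Rounding up loses at most a factor 2 in 2^K, so the first part is at
most (16/3)/ε². -/
lemma sum_inv_min_le (hH : 1 ≤ H) (hε : 0 < I.ε) (hεH : I.ε ≤ H / 8) :
    ∑ k ∈ Finset.Icc 1 (I.K H), 1 / min (eps H k ^ 2) 1
      ≤ 6 / I.ε ^ 2 + 2 * Real.log (H / I.ε) := by
  have hH0 : (0 : ℝ) < H := by exact_mod_cast hH
  have hgeom : ∀ n : ℕ, ∑ k ∈ Finset.Icc 1 n, (1 / eps H k ^ 2 + 1)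
      ≤ 4 / 3 * 4 ^ n / (H : ℝ) ^ 2 + n := by
    intro n
    induction n with
    | zero => simp; positivity
    | succ n ih =>
      rw [Finset.sum_Icc_succ_top (by omega)]
      have e : 1 / eps H (n + 1) ^ 2 = 4 ^ (n + 1) / (H : ℝ) ^ 2 := by
        rw [eps, div_pow, one_div_div, ← pow_mul, mul_comm, pow_mul]; norm_num
      rw [e]
      have e2 : 4 / 3 * 4 ^ n / (H : ℝ) ^ 2 + 4 ^ (n + 1) / (H : ℝ) ^ 2
          = 4 / 3 * 4 ^ (n + 1) / (H : ℝ) ^ 2 := by rw [pow_succ]; field_simp; ring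
      push_cast
      linarith
  calc _ ≤ ∑ k ∈ Finset.Icc 1 (I.K H), (1 / eps H k ^ 2 + 1) := by
        refine Finset.sum_le_sum fun k _ => ?_
        have hE := eps_pos hH k
        have hp : 0 < 1 / eps H k ^ 2 := by positivity
        rcases le_total (eps H k ^ 2) 1 with h | h
        · rw [min_eq_left h]; linarith
        · rw [min_eq_right h]; linarith
    _ ≤ 4 / 3 * 4 ^ I.K H / (H : ℝ) ^ 2 + I.K H := hgeom _
    _ ≤ _ := by
        refine add_le_add ?_ (I.K_le hε hεH)
        have h4 : (4 : ℝ) ^ I.K H ≤ (2 * (H / I.ε)) ^ 2 := by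
          calc (4 : ℝ) ^ I.K H = (2 ^ I.K H) ^ 2 := by
                rw [← pow_mul, mul_comm, pow_mul]; norm_num
            _ ≤ _ := pow_le_pow_left₀ (by positivity) (I.two_pow_K_le hε hεH) 2
        rw [div_le_iff₀ (by positivity)]
        have e : 6 / I.ε ^ 2 * (H : ℝ) ^ 2 = 3 / 2 * (2 * (H / I.ε)) ^ 2 := by
          field_simp; norm_num
        rw [e]
        nlinarith [sq_nonneg (2 * ((H : ℝ) / I.ε))]

variable [Fintype A]

lemma numCalls_eq : (I.numCalls H : ℝ)
    = I.S.card * Fintype.card A *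
      (∑ k ∈ Finset.Icc 1 (I.K H), (I.m H k : ℝ) + I.K H * H * I.l H) := by
  have : I.numCalls H = I.S.card * Fintype.card A
      * (∑ k ∈ Finset.Icc 1 (I.K H), I.m H k + I.K H * H * I.l H) := by
    rw [numCalls, Fintype.card_sum, Fintype.card_sigma]
    simp only [Fintype.card_prod, Fintype.card_fin, Fintype.card_coe, Nat.card_Icc,
      Nat.add_sub_cancel]
    rw [Finset.sum_coe_sort (Finset.Icc 1 (I.K H))
      (fun k => I.S.card * (Fintype.card A * I.m H k)), ← Finset.mul_sum, ← Finset.mul_sum]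
    ring
  rw [this]
  push_cast
  ring

variable [Nonempty A]

lemma two_le_log_arg (hS : I.S.Nonempty) (hH : 1 ≤ H) (hε : 0 < I.ε) (hδ : 0 < I.δ)
    (hδ1 : I.δ < 1) (hεH : I.ε ≤ H / 8) :
    2 ≤ H * I.S.card * Fintype.card A / I.δ * Real.log (H / I.ε) := by
  have hy := I.log_div_ge hε hεH
  have h1 : (1 : ℝ) ≤ H * I.S.card * Fintype.card A := by
    have h1 := hS.card_pos
    have h2 := Fintype.card_pos (α := A)
    have : 1 ≤ H * I.S.card * Fintype.card A := Nat.one_le_iff_ne_zero.2 (by positivity)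
    exact_mod_cast this
  have h2 : 1 ≤ H * I.S.card * Fintype.card A / I.δ := by rw [le_div_iff₀ hδ]; linarith
  nlinarith

lemma logTerm_le (hS : I.S.Nonempty) (hH : 1 ≤ H) (hε : 0 < I.ε) (hδ : 0 < I.δ)
    (hδ1 : I.δ < 1) (hεH : I.ε ≤ H / 8) :
    I.logTerm H
      ≤ 6 * Real.log (H * I.S.card * Fintype.card A / I.δ * Real.log (H / I.ε)) := by
  have hw := I.two_le_log_arg hS hH hε hδ hδ1 hεH
  have hK := I.K_le hε hεH
  have hN := I.one_le_card_mul hS hH (I.one_le_K hε hεH)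
  have hwpos := hw
  set w := H * I.S.card * Fintype.card A / I.δ * Real.log (H / I.ε) with hwdef
  have hle : 16 * H * I.S.card * Fintype.card A * I.K H / I.δ ≤ 32 * w := by
    have e : 32 * w = 16 * H * I.S.card * Fintype.card A * (2 * Real.log (H / I.ε)) / I.δ := by
      rw [hwdef]; ring
    rw [e]
    gcongr
  have hpos : 0 < 16 * (H : ℝ) * I.S.card * Fintype.card A * I.K H / I.δ := by
    rw [show 16 * (H : ℝ) * I.S.card * Fintype.card A * I.K H
      = 16 * (H * I.S.card * Fintype.card A * I.K H) by ring]
    exact div_pos (by linarith) hδ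
  calc I.logTerm H ≤ Real.log (32 * w) := Real.log_le_log hpos hle
    _ = 5 * Real.log 2 + Real.log w := by
        rw [Real.log_mul (by norm_num) (by linarith), show (32 : ℝ) = 2 ^ 5 by norm_num,
          Real.log_pow]
        norm_num
    -- Since w ≥ 2, the term 5 log 2 is at most 5 log w.
    _ ≤ _ := by linarith [Real.log_le_log (by norm_num) hw]

lemma numCalls_le (hS : I.S.Nonempty) (hH : 1 ≤ H) (hε : 0 < I.ε) (hδ : 0 < I.δ)
    (hδ1 : I.δ < 1) (hεH : I.ε ≤ H / 8) :
    (I.numCalls H : ℝ) ≤ 15360 * (H ^ 3 * I.S.card * Fintype.card A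
      * (1 / I.ε ^ 2 + Real.log (H / I.ε))
      * Real.log (H * I.S.card * Fintype.card A / I.δ * Real.log (H / I.ε))) := by
  have hH1 : (1 : ℝ) ≤ H := by exact_mod_cast hH
  have hK := I.one_le_K hε hεH
  have hLT1 := I.one_le_logTerm hS hH hK hδ hδ1
  have hLT := I.logTerm_le hS hH hε hδ hδ1 hεH
  have hy := I.log_div_ge hε hεH
  -- The quantity rounded up is at least 1, so rounding at most doubles it.
  have hm : ∀ k, (I.m H k : ℝ) ≤ 256 * (H : ℝ) ^ 3 * I.logTerm H * (1 / min (eps H k ^ 2) 1) := by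
    intro k
    have hE := eps_pos hH k
    have hmin : 0 < min (eps H k ^ 2) 1 := lt_min (by positivity) one_pos
    have h1 : 1 ≤ 128 * (H : ℝ) ^ 3 / min (eps H k ^ 2) 1 * I.logTerm H := by
      have h2 : 1 ≤ 128 * (H : ℝ) ^ 3 / min (eps H k ^ 2) 1 := by
        rw [le_div_iff₀ hmin]
        have := min_le_right (eps H k ^ 2) (1 : ℝ)
        have := one_le_pow₀ hH1 (n := 3)
        linarith
      nlinarith
    have h3 : (I.m H k : ℝ) < 128 * (H : ℝ) ^ 3 / min (eps H k ^ 2) 1 * I.logTerm H + 1 :=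
      Nat.ceil_lt_add_one (by linarith)
    have e : 256 * (H : ℝ) ^ 3 * I.logTerm H * (1 / min (eps H k ^ 2) 1)
        = 2 * (128 * (H : ℝ) ^ 3 / min (eps H k ^ 2) 1 * I.logTerm H) := by ring
    linarith
  have hl : (I.l H : ℝ) ≤ 1024 * (H : ℝ) ^ 2 * I.logTerm H := by
    have hL4 := I.one_le_log_div hS hH hK hδ hδ1 (c := 4) le_rfl
    have hN := I.one_le_card_mul hS hH hK
    have hle : Real.log (4 * H * I.S.card * Fintype.card A * I.K H / I.δ) ≤ I.logTerm H := by
      refine Real.log_le_log ?_ ?_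
      · rw [show 4 * (H : ℝ) * I.S.card * Fintype.card A * I.K H
          = 4 * (H * I.S.card * Fintype.card A * I.K H) by ring]
        exact div_pos (by linarith) hδ
      · gcongr; norm_num
    have h3 : (I.l H : ℝ) < 512 * (H : ℝ) ^ 2
        * Real.log (4 * H * I.S.card * Fintype.card A * I.K H / I.δ) + 1 :=
      Nat.ceil_lt_add_one (by positivity)
    have h4 : 512 * (H : ℝ) ^ 2 * Real.log (4 * H * I.S.card * Fintype.card A * I.K H / I.δ)
        ≤ 512 * (H : ℝ) ^ 2 * I.logTerm H := by gcongr
    have h5 : 1 ≤ 512 * (H : ℝ) ^ 2 * I.logTerm H := by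
      have := one_le_pow₀ hH1 (n := 2)
      nlinarith
    linarith
  have hsum : ∑ k ∈ Finset.Icc 1 (I.K H), (I.m H k : ℝ)
      ≤ 256 * (H : ℝ) ^ 3 * I.logTerm H * (6 / I.ε ^ 2 + 2 * Real.log (H / I.ε)) := by
    calc _ ≤ ∑ k ∈ Finset.Icc 1 (I.K H),
          256 * (H : ℝ) ^ 3 * I.logTerm H * (1 / min (eps H k ^ 2) 1) :=
          Finset.sum_le_sum fun k _ => hm k
      _ ≤ _ := by
          rw [← Finset.mul_sum]
          exact mul_le_mul_of_nonneg_left (I.sum_inv_min_le hH hε hεH) (by positivity)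
  have hfresh : (I.K H : ℝ) * H * I.l H
      ≤ 2 * Real.log (H / I.ε) * H * (1024 * (H : ℝ) ^ 2 * I.logTerm H) := by
    gcongr
    exact I.K_le hε hεH
  rw [numCalls_eq]
  set y := Real.log (H / I.ε)
  set Λ := Real.log (H * I.S.card * Fintype.card A / I.δ * y)
  -- The coefficient of the logarithm is 512 from the initial batches plus 2048 from the fresh ones;
  -- that of 1/ε² is only 1536.
  have htotal : ∑ k ∈ Finset.Icc 1 (I.K H), (I.m H k : ℝ) + I.K H * H * I.l H
      ≤ 2560 * (H : ℝ) ^ 3 * (1 / I.ε ^ 2 + y) * (6 * Λ) := by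
    calc _ ≤ 2560 * (H : ℝ) ^ 3 * (1 / I.ε ^ 2 + y) * I.logTerm H := by
          have e : 6 / I.ε ^ 2 = 6 * (1 / I.ε ^ 2) := by ring
          rw [e] at hsum
          have h0 : 0 ≤ (H : ℝ) ^ 3 * I.logTerm H * (1 / I.ε ^ 2) := by positivity
          linarith
      _ ≤ _ := mul_le_mul_of_nonneg_left hLT (by positivity)
  calc _ ≤ I.S.card * Fintype.card A * (2560 * (H : ℝ) ^ 3 * (1 / I.ε ^ 2 + y) * (6 * Λ)) :=
        mul_le_mul_of_nonneg_left htotal (by positivity)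
    _ = _ := by ring

lemma numCalls_le_of_small (hS : I.S.Nonempty) (hH : 1 ≤ H) (hε : 0 < I.ε) (hδ : 0 < I.δ)
    (hδ1 : I.δ < 1) (hεH : I.ε ≤ H / 8) (hsmall : I.ε ^ 2 * Real.log (H / I.ε) ≤ 1) :
    (I.numCalls H : ℝ) ≤ 30720 * (H ^ 3 * I.S.card * Fintype.card A / I.ε ^ 2
      * Real.log (H * I.S.card * Fintype.card A / I.δ * Real.log (H / I.ε))) := by
  have hw := I.two_le_log_arg hS hH hε hδ hδ1 hεH
  have hΛ := Real.log_nonneg (x := H * I.S.card * Fintype.card A / I.δ * Real.log (H / I.ε))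
    (by linarith)
  refine (I.numCalls_le hS hH hε hδ hδ1 hεH).trans ?_
  set y := Real.log (H / I.ε)
  set Λ := Real.log (H * I.S.card * Fintype.card A / I.δ * y)
  have hy : 1 / I.ε ^ 2 + y ≤ 2 * (1 / I.ε ^ 2) := by
    have : y ≤ 1 / I.ε ^ 2 := by rw [le_div_iff₀ (by positivity)]; linarith
    linarith
  calc _ ≤ 15360 * ((H : ℝ) ^ 3 * I.S.card * Fintype.card A * (2 * (1 / I.ε ^ 2)) * Λ) := by
        gcongr
    _ = _ := by ring

end SolverInput

/-! ### Discretization -/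

section Discretization

lemma IsNet.nonempty {X : Type*} [MetricSpace X] [Nonempty X] {S : Finset X} {n : ℕ} (h : IsNet S n) : S.Nonempty := by
  obtain ⟨s, hs, -⟩ := h (Classical.arbitrary X)
  exact ⟨s, hs⟩

variable {X A : Type*} [MetricSpace X] [MeasurableSpace X]

/-- A net point is at distance zero from itself, so its nearest neighbour must be itself. -/
lemma IsQuantizer.map_self {S : Finset X} {Q : X → S} (hQ : IsQuantizer S Q) (x : X) :
    Q (Q x) = Q x := by
  have h := hQ.2 (Q x) (Q x) (Q x).2
  rw [dist_self] at h
  exact Subtype.ext (dist_le_zero.1 h).symm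

/-- The nearest net point is no farther than the one provided by the net property, so every state is
within 1/n of its cell centre. This is the only place where the metric enters the error analysis. -/
lemma MDP.IsHolder.cellRegular [MeasurableSpace A] {M : MDP X A} {I : SolverInput X A}
    (h : M.IsHolder I.L I.α) (hnet : IsNet I.S I.n) (hQ : IsQuantizer I.S I.Q) :
    I.CellRegular M := by
  obtain ⟨hL, hα, hr, hp⟩ := h
  have hdist : ∀ x, I.L * dist x (I.Q x : X) ^ I.α ≤ I.disc := by
    intro x
    obtain ⟨s, hs, hxs⟩ := hnet x
    have h1 : dist x (I.Q x : X) ≤ 1 / (I.n : ℝ) := (hQ.2 x s hs).trans hxs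
    unfold SolverInput.disc
    rw [Real.rpow_neg (Nat.cast_nonneg _), ← Real.inv_rpow (Nat.cast_nonneg _), ← one_div]
    exact mul_le_mul_of_nonneg_left (Real.rpow_le_rpow dist_nonneg h1 hα) hL
  exact ⟨fun x a => (hr x _ a).trans (hdist x), fun x a => (hp x _ a).trans (hdist x)⟩

end Discretization

/-! ### The main theorem -/

theorem mainTheorem11 :
    ∃ C : ℝ, 0 < C ∧
    ∀ (X A : Type*) [MetricSpace X] [CompactSpace X] [Nonempty X]
      [MeasurableSpace X] [BorelSpace X]
      [Fintype A] [Nonempty A] [MeasurableSpace A] [DiscreteMeasurableSpace A]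
      (M : MDP X A) (I : SolverInput X A),
      1 ≤ I.n → IsNet I.S I.n → IsQuantizer I.S I.Q →
      (∀ (f : A → ℝ) (a : A), f a ≤ f (I.argmax f)) →
      (∀ t, Measurable (I.π₀ t)) →
      0 < I.ε → 0 < I.δ → I.δ < 1 →
      M.IsHolder I.L I.α → I.disc ≤ 1 / (16 * M.H) →
      -- the computed functions are bounded and measurable
      (∀ ω k t, Measurable (I.u M.H M.r ω k t) ∧ ∃ B, ∀ x, |I.u M.H M.r ω k t x| ≤ B) ∧
      -- the computed decision rules form deterministic policies, and the guarantees hold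
      -- outside an event of probability at most `δ`
      (∃ hπ : ∀ ω k t, Measurable (I.pol M.H M.r ω k t),
        I.answerLaw M.H M.p
          {ω | ¬ ((∀ x, ∀ t ∈ Finset.Icc 1 M.H, ∀ k ∈ Finset.Icc 1 (I.K M.H),
                    M.optValue t x - SolverInput.eps M.H k - 12 * I.disc * M.H ^ 2
                      ≤ I.u M.H M.r ω k t x ∧
                    I.u M.H M.r ω k t x
                      ≤ M.value (Policy.det (I.pol M.H M.r ω k) (hπ ω k)) t x ∧
                    M.value (Policy.det (I.pol M.H M.r ω k) (hπ ω k)) t x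
                      ≤ M.optValue t x) ∧
                  (∀ x,
                    M.optValue 1 x - I.ε - 12 * I.disc * M.H ^ 2
                      ≤ M.value (Policy.det (I.pol M.H M.r ω (I.K M.H)) (hπ ω _)) 1 x ∧
                    M.value (Policy.det (I.pol M.H M.r ω (I.K M.H)) (hπ ω _)) 1 x
                      ≤ M.optValue 1 x) ∧
                  M.IsOptimalUpTo (I.ε + 12 * I.disc * M.H ^ 2)
                    (Policy.det (I.pol M.H M.r ω (I.K M.H)) (hπ ω _)))}
          ≤ ENNReal.ofReal I.δ) ∧
      -- number of oracle calls
      (I.ε ≤ M.H / 8 →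
        (I.numCalls M.H : ℝ) ≤
          C * (M.H ^ 3 * I.S.card * Fintype.card A * (1 / I.ε ^ 2 + Real.log (M.H / I.ε))
            * Real.log (M.H * I.S.card * Fintype.card A / I.δ * Real.log (M.H / I.ε)))) ∧
      (I.ε ≤ M.H / 8 → I.ε ^ 2 * Real.log (M.H / I.ε) ≤ 1 →
        (I.numCalls M.H : ℝ) ≤
          C * (M.H ^ 3 * I.S.card * Fintype.card A / I.ε ^ 2
            * Real.log (M.H * I.S.card * Fintype.card A / I.δ * Real.log (M.H / I.ε)))) := by
  -- Twice 15360; the factor 2 serves the regime where log(H/ε) ≤ 1/ε².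
  refine ⟨30720, by norm_num, ?_⟩
  intro X A _ _ _ _ _ _ _ _ _ M I _ hnet hquant hmax hπ₀ hε hδ hδ1 hholder hdiscH
  have hQm := hquant.1
  have hQ := hquant.map_self
  have hS := hnet.nonempty
  have hreg := hholder.cellRegular hnet hquant
  have hdisc := hreg.disc_nonneg
  have hH := M.one_le_H
  refine ⟨fun ω k t => ⟨SolverInput.measurable_u_apply hQm ω k t,
    I.exists_abs_u_le M.H M.r hQ ω k t⟩,
    ⟨fun ω k t => I.measurable_pol M.H M.r hQm hπ₀ ω k t, ?_⟩, ?_, ?_⟩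
  -- Inclusion in the complement of the good event suffices, so the failure set itself need not be
  -- measurable.
  · refine (measure_mono ?_).trans (I.answerLaw_not_allAccurate_le M hQm hQ hS hδ hδ1 hdisc)
    intro ω hω hacc
    apply hω
    have hinv : ∀ k ≤ I.K M.H, I.EpochInvariant M ω k := fun k hk =>
      hacc.epochInvariant hQm hQ hreg hmax hdiscH
        (fun hK => I.one_le_logTerm hS hH hK hδ hδ1) hk
    have hone : 1 ∈ Finset.Icc 1 M.H := Finset.mem_Icc.2 ⟨le_rfl, hH⟩
    have hfinal : ∀ x, M.optValue 1 x - I.ε - 12 * I.disc * M.H ^ 2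
        ≤ M.value (Policy.det (I.pol M.H M.r ω (I.K M.H))
          fun t => I.measurable_pol M.H M.r hQm hπ₀ ω _ t) 1 x := by
      intro x
      have h1 := (hinv _ le_rfl).lower 1 hone x
      have h2 := (hinv _ le_rfl).u_le_value hQm hQ
        (fun t => I.measurable_pol M.H M.r hQm hπ₀ ω _ t) 1 le_rfl x
      have h3 := M.optValue_le_bellmanAt 1 x
      have h4 := I.eps_K_le hH hε
      linarith
    refine ⟨fun x t ht k hk => ⟨?_, ?_, M.value_le_optValue _ _ _⟩,
      fun x => ⟨hfinal x, M.value_le_optValue _ _ _⟩, fun x π' => ?_⟩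
    · have h1 := (hinv k (Finset.mem_Icc.1 hk).2).lower t ht x
      have h2 := M.optValue_le_bellmanAt t x
      linarith
    · exact (hinv k (Finset.mem_Icc.1 hk).2).u_le_value hQm hQ _ t (Finset.mem_Icc.1 ht).1 x
    · have h1 := M.value_le_optValue π' 1 x
      have h2 := hfinal x
      linarith
  · intro hεH
    refine (I.numCalls_le hS hH hε hδ hδ1 hεH).trans
      (mul_le_mul_of_nonneg_right (by norm_num) ?_)
    have hw := I.two_le_log_arg hS hH hε hδ hδ1 hεH
    have hΛ := Real.log_nonneg
      (x := M.H * I.S.card * Fintype.card A / I.δ * Real.log (M.H / I.ε)) (by linarith)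
    have hy := I.log_div_ge hε hεH
    positivity
  · intro hεH hsmall
    exact I.numCalls_le_of_small hS hH hε hδ hδ1 hεH hsmall
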